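/- **Model.** A hypothesis $H\in\{0,1\}$ has an arbitrary prior $P(H=0)=p_0$. There are sensors $1,\dots,N$; sensor $j$ makes observations $Y^j_1,Y^j_2,\dots$ in a measurable space $\mathcal Y^j$. Given $H$, the observations of each sensor at different times are independent, and the observation sequences of different sensors are independent (the conditional laws of the observations, which may depend on sensor and time, are arbitrary, e.g. discrete or with densities). A directed graph is given, and $\mathcal P^j$ is the set of sensors with an edge to $j$. There is a finite horizon $T\ge 1$. A strategy of sensor $j$ is a family of measurable decision rules $\gamma^j_t$, $t\ge1$, with values in $\{0,1,b\}$ ($b$ = blank), such that $\gamma^j_T$ never takes the value $b$. If sensor $j$ has not stopped before time $t$ (that is, $U^j_s=b$ for all $s<t$), then $U^j_t=\gamma^j_t(Y^j_{1:t},U^{\mathcal P^j}_{1:t-1})$; otherwise $U^j_t=b$. Let $\tau^j=\min\{t:U^j_t\ne b\}\le T$. The system cost is $J=O(\tau^1,\dots,\tau^N)+A(H,U^1_{\tau^1},\dots,U^N_{\tau^N},\tau^1,\dots,\tau^N)$ with arbitrary real-valued $O$, $A$. Fix a sensor $i$ and the strategies of all sensors $j\ne i$. For a strategy $g$ of sensor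 $i$, its belief is $$\Pi^i_t=P\big(H=0\,\big|\,Y^i_{1:t},U^{\mathcal P^i}_{1:t-1},U^i_{1:t-1}=b_{1:t-1}\big).$$ The dynamic program is given by measurable functions of realizations $(\pi,u)$ of $(\Pi^i_t,U^{\mathcal P^i}_{1:t-1})$: $$W^a_t(\pi,u)=E\big[J\,\big|\,\Pi^i_t=\pi,\,U^{\mathcal P^i}_{1:t-1}=u,\,U^i_{1:t-1}=b_{1:t-1},\,U^i_t=a\big],\qquad a\in\{0,1\},\ 1\le t\le T,$$ $$C_t(\pi,u)=E\big[V^i_{t+1}(\Pi^i_{t+1},U^{\mathcal P^i}_{1:t})\,\big|\,\Pi^i_t=\pi,\,U^{\mathcal P^i}_{1:t-1}=u,\,U^i_{1:t-1}=b_{1:t-1},\,U^i_t=b\big],\qquad 1\le t<T,$$ $$V^i_T=\min\{W^0_T,W^1_T\},\qquad V^i_t=\min\{W^0_t,W^1_t,C_t\}\quad(1\le t<T),$$ where the same functions $W^a_t$, $C_t$ are to be versions of these conditional expectations under every strategy $g$ of sensor $i$ and for every version of its belief. **Theorem.** Such a dynamic program exists. For every version of it there are measurable functions $\gamma_t(\pi,u)\in\{0,1,b\}$,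 $1\le t\le T$, that select at each $(\pi,u)$ a decision whose term attains the minimum in $V^i_t(\pi,u)$: $0$ only if $W^0_t=V^i_t$, $1$ only if $W^1_t=V^i_t$, $b$ only if $t<T$ and $C_t=V^i_t$. For every such selection $\gamma$: 1. there is a strategy of sensor $i$ of the form $U^i_t=\gamma_t(\Pi^i_t,U^{\mathcal P^i}_{1:t-1})$, $t=1,\dots,T$ (where $\Pi^i_t$ is its own belief), that is optimal, i.e. minimizes $E[J]$ over all strategies of sensor $i$; 2. every strategy of sensor $i$ of this form is optimal; 3. for each $t\in\{1,\dots,T\}$, every strategy that has this form from time $t$ on almost surely minimizes $E[J\mid Y^i_{1:t},U^{\mathcal P^i}_{1:t-1},U^i_{1:t-1}=b_{1:t-1}]$ among all strategies of sensor $i$ with the same decision rules before time $t$. -/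

import Mathlib

open MeasureTheory ProbabilityTheory

noncomputable section

namespace SeqDetect

universe u v

/-- A decision of a sensor at one time: `some 0`, `some 1`, or `none`, which is the blank `b`
(continue, or already stopped). -/
abbrev Decision : Type := Option (Fin 2)

instance instMeasurableSpaceDecision : MeasurableSpace Decision := ⊤

/-- Realizations `y_{1:t}` of the observations of a sensor with observation space `Y`. -/
abbrev ObsHist (Y : Type v) (t : ℕ) : Type v := Finset.Icc 1 t → Y

/-- Realizations `u^{P^i}_{1:t-1}` of the messages that sensor `i` receives before time `t`;
`edge j i` says that the decisions of sensor `j` are communicated to sensor `i`. -/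
abbrev MsgHist {N : ℕ} (edge : Fin N → Fin N → Prop) (i : Fin N) (t : ℕ) : Type :=
  {j : Fin N // edge j i} → Finset.Ico 1 t → Decision

/-- The sequential detection problem. Times are `1, 2, …`; values at time `0` are dummies which
are never used. Conditional independence given `H` is independence under the conditional measure
given each value of `H` that has positive probability. -/
structure DetectionModel (N : ℕ) (Ω : Type u) [MeasurableSpace Ω]
    (Y : Fin N → Type v) [∀ i, MeasurableSpace (Y i)] where
  /-- the underlying probability measure -/
  P : Measure Ω
  isProbabilityMeasure_P : IsProbabilityMeasure P
  /-- the true hypothesis -/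
  H : Ω → Fin 2
  measurable_H : Measurable H
  /-- `obs i t` is the observation of sensor `i` at time `t` -/
  obs : ∀ i : Fin N, ℕ → Ω → Y i
  measurable_obs : ∀ i t, Measurable (obs i t)
  /-- given `H`, the observations of one sensor at different times are independent -/
  indep_times : ∀ h : Fin 2, P (H ⁻¹' {h}) ≠ 0 → ∀ i : Fin N,
    iIndepFun (fun t : ℕ => obs i t) (cond P (H ⁻¹' {h}))
  /-- given `H`, the observation sequences of different sensors are independent -/
  indep_sensors : ∀ h : Fin 2, P (H ⁻¹' {h}) ≠ 0 →
    iIndepFun (fun (i : Fin N) (ω : Ω) (t : ℕ) => obs i t ω) (cond P (H ⁻¹' {h}))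
  /-- the directed communication graph: sensor `i` communicates its decision to sensor `j` -/
  edge : Fin N → Fin N → Prop
  /-- the horizon -/
  T : ℕ
  one_le_T : 1 ≤ T
  /-- operational cost, a function of the stopping times -/
  opCost : (Fin N → ℕ) → ℝ
  /-- terminal cost, a function of the hypothesis, the final decisions (which are never blank) and
  the stopping times -/
  termCost : Fin 2 → (Fin N → Decision) → (Fin N → ℕ) → ℝ

/-- `w` is a version of `x ↦ E[f | S = x, B]`, the conditional expectation of `f` given the random
variable `S` and the event `B`. (There is no condition on the values of `w` if `B` is null.) -/
def IsCondExpGiven {Ω : Type*} [MeasurableSpace Ω] {X : Type*} [MeasurableSpace X]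
    (P : Measure Ω) (B : Set Ω) (S : Ω → X) (f : Ω → ℝ) (w : X → ℝ) : Prop :=
  Measurable w ∧
    (fun ω => w (S ω)) =ᵐ[cond P B] condExp (MeasurableSpace.comap S inferInstance) (cond P B) f

namespace DetectionModel

variable {N : ℕ} {Ω : Type u} [MeasurableSpace Ω] {Y : Fin N → Type v}
  [∀ i, MeasurableSpace (Y i)]

/-- A decision strategy of sensor `i`: a (measurable) decision rule for each time, depending on
`y^i_{1:t}` and `u^{P^i}_{1:t-1}`, which is used while the sensor has not stopped. A sensor that is
still active at the horizon has to stop. -/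
structure Strategy (M : DetectionModel N Ω Y) (i : Fin N) where
  rule : ∀ t : ℕ, ObsHist (Y i) t × MsgHist M.edge i t → Decision
  measurable_rule : ∀ t, Measurable (rule t)
  rule_T : ∀ x, rule M.T x ≠ none

/-- One strategy for each sensor. -/
abbrev Profile (M : DetectionModel N Ω Y) : Type v := ∀ i : Fin N, M.Strategy i

variable (M : DetectionModel N Ω Y)

/-- The decision of sensor `j` at time `t`, as a function of the observations `y` of all sensors:
blank if the sensor has stopped before, and given by its decision rule otherwise. -/
def decisionOf (Γ : M.Profile) (y : ∀ i, ℕ → Y i) (t : ℕ) (j : Fin N) : Decision :=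
  if ∀ s : Finset.Ico 1 t, decisionOf Γ y s j = none then
    (Γ j).rule t (fun s => y j s, fun k s => decisionOf Γ y s k)
  else none
termination_by t
decreasing_by all_goals exact (Finset.mem_Ico.mp (Subtype.property _)).2

/-- The random variable `U^j_t`. -/
def U (Γ : M.Profile) (t : ℕ) (j : Fin N) (ω : Ω) : Decision :=
  M.decisionOf Γ (fun i s => M.obs i s ω) t j

/-- The information `(Y^i_{1:t}, U^{P^i}_{1:t-1})` of sensor `i` at time `t`. -/
def info (Γ : M.Profile) (i : Fin N) (t : ℕ) (ω : Ω) : ObsHist (Y i) t × MsgHist M.edge i t :=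
  (fun s => M.obs i s ω, fun k s => M.U Γ s k ω)

/-- The event `U^i_{1:t-1} = b_{1:t-1}` that sensor `i` has not stopped before time `t`. -/
def active (Γ : M.Profile) (i : Fin N) (t : ℕ) : Set Ω :=
  {ω | ∀ s ∈ Finset.Ico 1 t, M.U Γ s i ω = none}

/-- The stopping time `τ^j = min {t ≥ 1 : U^j_t ≠ b}`. -/
def tau (Γ : M.Profile) (j : Fin N) (ω : Ω) : ℕ :=
  sInf {t : ℕ | 1 ≤ t ∧ M.U Γ t j ω ≠ none}

/-- The total system cost `J`. -/
def cost (Γ : M.Profile) (ω : Ω) : ℝ :=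
  M.opCost (fun j => M.tau Γ j ω) +
    M.termCost (M.H ω) (fun j => M.U Γ (M.tau Γ j ω) j ω) (fun j => M.tau Γ j ω)

/-- The expected system cost. -/
def expectedCost (Γ : M.Profile) : ℝ := ∫ ω, M.cost Γ ω ∂M.P

/-- The profile in which sensor `i` uses `g` and every other sensor `j` uses `Γ j`. -/
def withStrategy (Γ : M.Profile) (i : Fin N) (g : M.Strategy i) : M.Profile :=
  Function.update Γ i g

/-- With the strategies of the other sensors fixed, `g` is an optimal strategy of sensor `i`. -/
def IsOptimal (Γ : M.Profile) (i : Fin N) (g : M.Strategy i) : Prop :=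
  ∀ g' : M.Strategy i,
    M.expectedCost (M.withStrategy Γ i g) ≤ M.expectedCost (M.withStrategy Γ i g')

/-- The strategy `g` is optimal for sensor `i` from time `t` on: given the information at time `t`
and that the sensor is still active, its conditional expected cost is almost surely at most that
of any strategy with the same decision rules before time `t`. -/
def IsOptimalFrom (Γ : M.Profile) (i : Fin N) (t : ℕ) (g : M.Strategy i) : Prop :=
  ∀ g' : M.Strategy i, (∀ s ∈ Finset.Ico 1 t, g'.rule s = g.rule s) →
    condExp (MeasurableSpace.comap (M.info (M.withStrategy Γ i g) i t) inferInstance)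
        (cond M.P (M.active (M.withStrategy Γ i g) i t)) (M.cost (M.withStrategy Γ i g))
      ≤ᵐ[cond M.P (M.active (M.withStrategy Γ i g) i t)]
    condExp (MeasurableSpace.comap (M.info (M.withStrategy Γ i g') i t) inferInstance)
        (cond M.P (M.active (M.withStrategy Γ i g') i t)) (M.cost (M.withStrategy Γ i g'))

/-- `π` gives the belief of sensor `i` under the profile `Γ` (which includes sensor `i`):
`Π_t = π t (Y^i_{1:t}, U^{P^i}_{1:t-1})` is
`P(H = 0 | Y^i_{1:t}, U^{P^i}_{1:t-1}, U^i_{1:t-1} = b_{1:t-1})`. -/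
def IsBelief (Γ : M.Profile) (i : Fin N)
    (π : ∀ t : ℕ, ObsHist (Y i) t × MsgHist M.edge i t → ℝ) : Prop :=
  ∀ t ∈ Finset.Icc 1 M.T,
    IsCondExpGiven M.P (M.active Γ i t) (M.info Γ i t)
      (Set.indicator (M.H ⁻¹' {0}) (fun _ => (1 : ℝ))) (π t)

/-- The information state `(Π_t, U^{P^i}_{1:t-1})`. -/
def state (Γ : M.Profile) (i : Fin N)
    (π : ∀ t : ℕ, ObsHist (Y i) t × MsgHist M.edge i t → ℝ) (t : ℕ) (ω : Ω) :
    ℝ × MsgHist M.edge i t :=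
  (π t (M.info Γ i t ω), (M.info Γ i t ω).2)

/-- The dynamic program of sensor `i` for the strategies `Γ j`, `j ≠ i`. At time `t`, `W a t` is
the term of the decision `a ∈ {0, 1}`, `C t` is the term of the decision `b`, and `V t` is the value
function. All are functions of the realization of the information state, and they do not depend on
the strategy `g` of sensor `i`: the conditional expectations that define them are to be right under
every `g`. -/
structure IsDynamicProgram (Γ : M.Profile) (i : Fin N)
    (W : Fin 2 → ∀ t : ℕ, ℝ × MsgHist M.edge i t → ℝ)
    (C V : ∀ t : ℕ, ℝ × MsgHist M.edge i t → ℝ) : Prop where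
  /-- `W a t (p, u) = E[J | Π_t = p, u_{1:t-1}, U^i_{1:t-1} = b_{1:t-1}, U^i_t = a]` -/
  stop_term : ∀ t ∈ Finset.Icc 1 M.T, ∀ (a : Fin 2) (g : M.Strategy i)
    (π : ∀ t : ℕ, ObsHist (Y i) t × MsgHist M.edge i t → ℝ),
    M.IsBelief (M.withStrategy Γ i g) i π →
    IsCondExpGiven M.P
      (M.active (M.withStrategy Γ i g) i t ∩ {ω | M.U (M.withStrategy Γ i g) t i ω = some a})
      (M.state (M.withStrategy Γ i g) i π t) (M.cost (M.withStrategy Γ i g)) (W a t)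
  /-- `C t (p, u) = E[V_{t+1}(Π_{t+1}, U_{1:t}) | Π_t = p, u_{1:t-1}, U^i_{1:t-1} = b_{1:t-1},
  U^i_t = b]` -/
  continue_term : ∀ t ∈ Finset.Ico 1 M.T, ∀ (g : M.Strategy i)
    (π : ∀ t : ℕ, ObsHist (Y i) t × MsgHist M.edge i t → ℝ),
    M.IsBelief (M.withStrategy Γ i g) i π →
    IsCondExpGiven M.P
      (M.active (M.withStrategy Γ i g) i t ∩ {ω | M.U (M.withStrategy Γ i g) t i ω = none})
      (M.state (M.withStrategy Γ i g) i π t)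
      (fun ω => V (t + 1) (M.state (M.withStrategy Γ i g) i π (t + 1) ω)) (C t)
  value_T : ∀ x, V M.T x = min (W 0 M.T x) (W 1 M.T x)
  value : ∀ t ∈ Finset.Ico 1 M.T, ∀ x, V t x = min (min (W 0 t x) (W 1 t x)) (C t x)

/-- `γ` is a (measurable) selection of minimizers in the dynamic program: each decision is one
whose term attains the minimum. At time `T` there is no term for the blank. -/
def IsMinimizer (i : Fin N) (W : Fin 2 → ∀ t : ℕ, ℝ × MsgHist M.edge i t → ℝ)
    (C V : ∀ t : ℕ, ℝ × MsgHist M.edge i t → ℝ)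
    (γ : ∀ t : ℕ, ℝ × MsgHist M.edge i t → Decision) : Prop :=
  ∀ t ∈ Finset.Icc 1 M.T, Measurable (γ t) ∧ ∀ x,
    (∀ a : Fin 2, γ t x = some a → W a t x = V t x) ∧
    (γ t x = none → t < M.T ∧ C t x = V t x)

/-- From time `t₀` on, the strategy `g` decides by `γ_t(Π_t, U^{P^i}_{1:t-1})`, where `π` gives the
belief. -/
def FollowsFrom (i : Fin N) (t₀ : ℕ) (g : M.Strategy i)
    (π : ∀ t : ℕ, ObsHist (Y i) t × MsgHist M.edge i t → ℝ)
    (γ : ∀ t : ℕ, ℝ × MsgHist M.edge i t → Decision) : Prop :=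
  ∀ t ∈ Finset.Icc t₀ M.T, ∀ x, g.rule t x = γ t (π t x, x.2)

end DetectionModel

end SeqDetect

end

/-!
Fix the strategies of the sensors other than `i`. As long as sensor `i` has not stopped, all other
sensors behave as if `i` never stopped before the horizon (`decisionOf_eq_waiting`), so that the
information of `i` at time `t` is that of a waiting sensor, `idleInfo`, whatever its strategy `g`;
the strategy only determines for which realizations of this information the sensor is active
(`active_eq_preimage`). Hence one function of the information, `belief`, is a belief under every
strategy (`isBelief_belief`).

Given the hypothesis `H`, the past observations `A` of sensor `i` are independent of the pair `B` of
its next observation and the observations of all other sensors, and the messages which the waiting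
sensor has received are a function `m B` with finitely many values. Therefore the conditional mean
of a function of `H` and `B`, given `H = h` and the information `(A, m B)`, depends on `m B` only,
and mixing over `h` with the belief gives a function of the state, that is, of the belief and the
messages (`exists_state_mean`). This applies to the cost of stopping at time `t`, which is a
function of `H` and the observations of the other sensors. It also yields the conditional
probability of `H = 0` given the current state, the next observation and the next messages, and
shows that this is already the next belief; no densities or explicit Bayes formula are needed.
Thus the conditional mean of a function of the next state is a function of the current state
(`exists_state_mean_next`). Backward recursion now gives a dynamic program with bounded terms
(`valueFn`, `isDynamicProgram_valueFn`).

Any other dynamic program agrees with this one almost surely at the states of the waiting sensor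
(`IsDynamicProgram.value_ae_eq`), as is seen by testing its defining property with the strategies
`stopAt`, under which the sensor is always active at time `t` and takes a prescribed
decision. Finally, backward induction shows that the value function bounds the conditional expected
cost of every strategy from below (`setIntegral_valueFn_le`), with equality for strategies that take
minimizing decisions (`AttainsFrom.setIntegral_eq`). All these statements are proved for integrals
over events that are generated by the information.
-/

noncomputable section

namespace SeqDetect

/-! ### Conditional expectations given a random variable and an event -/

section CondExpGiven

variable {Ω X : Type*} [MeasurableSpace Ω] [MeasurableSpace X] {P : Measure Ω}
  {B : Set Ω} {S : Ω → X} {f : Ω → ℝ} {w : X → ℝ}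

theorem setIntegral_cond {A : Set Ω} (hA : MeasurableSet A) (f : Ω → ℝ) :
    ∫ ω in A, f ω ∂(ProbabilityTheory.cond P B) =
      (P B)⁻¹.toReal * ∫ ω in A ∩ B, f ω ∂P := by
  rw [ProbabilityTheory.cond, Measure.restrict_smul, integral_smul_measure,
    Measure.restrict_restrict hA, smul_eq_mul]

theorem integrable_cond {f : Ω → ℝ} (hf : IntegrableOn f B P) :
    Integrable f (ProbabilityTheory.cond P B) := by
  by_cases h : P B = 0
  · rw [cond_eq_zero_of_meas_eq_zero h]
    exact integrable_zero_measure
  · exact Integrable.smul_measure hf (ENNReal.inv_ne_top.mpr h)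

theorem integrableOn_of_cond [IsFiniteMeasure P] {f : Ω → ℝ}
    (hf : Integrable f (ProbabilityTheory.cond P B)) : IntegrableOn f B P := by
  by_cases h : P B = 0
  · rw [IntegrableOn, Measure.restrict_eq_zero.mpr h]
    exact integrable_zero_measure
  · exact (integrable_smul_measure (ENNReal.inv_ne_zero.mpr (measure_ne_top P B))
      (ENNReal.inv_ne_top.mpr h)).mp hf

theorem restrict_absolutelyContinuous_cond [IsFiniteMeasure P] :
    P.restrict B ≪ ProbabilityTheory.cond P B :=
  Measure.absolutelyContinuous_smul (ENNReal.inv_ne_zero.mpr (measure_ne_top P B))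

theorem cond_absolutelyContinuous_restrict :
    ProbabilityTheory.cond P B ≪ P.restrict B :=
  Measure.smul_absolutelyContinuous

theorem ae_restrict_iff_ae_cond [IsFiniteMeasure P] {p : Ω → Prop} :
    (∀ᵐ ω ∂(P.restrict B), p ω) ↔ ∀ᵐ ω ∂(ProbabilityTheory.cond P B), p ω :=
  ⟨fun h => cond_absolutelyContinuous_restrict h,
    fun h => restrict_absolutelyContinuous_cond h⟩

theorem isCondExpGiven_of_forall_setIntegral [IsFiniteMeasure P]
    (hS : Measurable S) (hw : Measurable w) (hf : Integrable f P)
    (hwi : IntegrableOn (fun ω => w (S ω)) B P)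
    (h : ∀ D, MeasurableSet D → ∫ ω in S ⁻¹' D ∩ B, w (S ω) ∂P = ∫ ω in S ⁻¹' D ∩ B, f ω ∂P) :
    IsCondExpGiven P B S f w := by
  refine ⟨hw, ae_eq_condExp_of_forall_setIntegral_eq hS.comap_le
    (integrable_cond hf.integrableOn) (fun _ _ _ => (integrable_cond hwi).integrableOn) ?_ ?_⟩
  · rintro _ ⟨D, hD, rfl⟩ -
    rw [setIntegral_cond (hS hD), setIntegral_cond (hS hD), h D hD]
  · exact (hw.comp (comap_measurable S)).aestronglyMeasurable

theorem IsCondExpGiven.integrableOn [IsFiniteMeasure P]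
    (h : IsCondExpGiven P B S f w) : IntegrableOn (fun ω => w (S ω)) B P :=
  integrableOn_of_cond (integrable_condExp.congr h.2.symm)

theorem IsCondExpGiven.setIntegral_eq [IsFiniteMeasure P]
    (hS : Measurable S) (h : IsCondExpGiven P B S f w) (hf : Integrable f P) {D : Set X}
    (hD : MeasurableSet D) :
    ∫ ω in S ⁻¹' D ∩ B, w (S ω) ∂P = ∫ ω in S ⁻¹' D ∩ B, f ω ∂P := by
  have h1 : ∫ ω in S ⁻¹' D, w (S ω) ∂(ProbabilityTheory.cond P B) =
      ∫ ω in S ⁻¹' D, f ω ∂(ProbabilityTheory.cond P B) := by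
    rw [setIntegral_congr_ae (hS hD) (h.2.mono fun ω hω _ => hω),
      setIntegral_condExp hS.comap_le (integrable_cond hf.integrableOn) ⟨D, hD, rfl⟩]
  rw [setIntegral_cond (hS hD), setIntegral_cond (hS hD)] at h1
  by_cases h0 : P B = 0
  · have h2 : P (S ⁻¹' D ∩ B) = 0 := measure_mono_null Set.inter_subset_right h0
    rw [setIntegral_measure_zero _ h2, setIntegral_measure_zero _ h2]
  · exact mul_left_cancel₀ (ENNReal.toReal_ne_zero.mpr
      ⟨ENNReal.inv_ne_zero.mpr (measure_ne_top P B), ENNReal.inv_ne_top.mpr h0⟩) h1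

/-- Inequalities between functions of a random variable hold almost everywhere if they hold for the
integrals over the events that it generates. -/
theorem comp_ae_le_of_forall_setIntegral (hS : Measurable S) {w w' : X → ℝ}
    (hw : Measurable w) (hw' : Measurable w')
    (hi : Integrable (fun ω => w (S ω)) P) (hi' : Integrable (fun ω => w' (S ω)) P)
    (h : ∀ D, MeasurableSet D → ∫ ω in S ⁻¹' D, w (S ω) ∂P ≤ ∫ ω in S ⁻¹' D, w' (S ω) ∂P) :
    ∀ᵐ ω ∂P, w (S ω) ≤ w' (S ω) := by
  refine ae_of_ae_map hS.aemeasurable (p := fun x => w x ≤ w' x)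
    (ae_le_of_forall_setIntegral_le ?_ ?_ fun D hD _ => ?_)
  · exact (integrable_map_measure hw.aestronglyMeasurable hS.aemeasurable).mpr hi
  · exact (integrable_map_measure hw'.aestronglyMeasurable hS.aemeasurable).mpr hi'
  · rw [setIntegral_map hD hw.aestronglyMeasurable hS.aemeasurable,
      setIntegral_map hD hw'.aestronglyMeasurable hS.aemeasurable]
    exact h D hD

theorem comp_ae_eq_of_forall_setIntegral (hS : Measurable S) {w w' : X → ℝ}
    (hw : Measurable w) (hw' : Measurable w')
    (hi : Integrable (fun ω => w (S ω)) P) (hi' : Integrable (fun ω => w' (S ω)) P)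
    (h : ∀ D, MeasurableSet D → ∫ ω in S ⁻¹' D, w (S ω) ∂P = ∫ ω in S ⁻¹' D, w' (S ω) ∂P) :
    ∀ᵐ ω ∂P, w (S ω) = w' (S ω) := by
  filter_upwards [comp_ae_le_of_forall_setIntegral hS hw hw' hi hi' fun D hD => (h D hD).le,
    comp_ae_le_of_forall_setIntegral hS hw' hw hi' hi fun D hD => (h D hD).ge] with ω h1 h2
  exact le_antisymm h1 h2

/-- Every event has a version of its conditional probability given a random variable that takes
values in the unit interval. -/
theorem exists_condProb_version [IsFiniteMeasure P]
    (hS : Measurable S) {E : Set Ω} (hE : MeasurableSet E) :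
    ∃ ψ : X → ℝ, Measurable ψ ∧ (∀ x, ψ x ∈ Set.Icc (0 : ℝ) 1) ∧ ∀ D, MeasurableSet D →
      ∫ ω in S ⁻¹' D, ψ (S ω) ∂P = ∫ ω in S ⁻¹' D, E.indicator (fun _ => (1 : ℝ)) ω ∂P := by
  have hint : Integrable (E.indicator fun _ => (1 : ℝ)) P := (integrable_const 1).indicator hE
  obtain ⟨h, hh, hhe⟩ := (stronglyMeasurable_condExp (m := MeasurableSpace.comap S inferInstance)
    (μ := P) (f := E.indicator fun _ => (1 : ℝ))).measurable.exists_eq_measurable_comp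
  refine ⟨fun x => max 0 (min 1 (h x)), by fun_prop, fun x => ⟨le_max_left _ _,
    max_le zero_le_one (min_le_left _ _)⟩, fun D hD => ?_⟩
  have h0 : 0 ≤ᵐ[P] condExp (MeasurableSpace.comap S inferInstance) P
      (E.indicator fun _ => (1 : ℝ)) :=
    condExp_nonneg (.of_forall fun ω => Set.indicator_nonneg (fun _ _ => zero_le_one) ω)
  have h1 : condExp (MeasurableSpace.comap S inferInstance) P
      (E.indicator fun _ => (1 : ℝ)) ≤ᵐ[P] fun _ => 1 := by
    have := condExp_mono (m := MeasurableSpace.comap S inferInstance) hint (integrable_const 1)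
      (.of_forall fun ω => Set.indicator_le_self' (f := fun _ => (1 : ℝ))
        (fun _ _ => zero_le_one) ω)
    rwa [condExp_const hS.comap_le] at this
  rw [← setIntegral_condExp hS.comap_le hint ⟨D, hD, rfl⟩]
  refine setIntegral_congr_ae (hS hD) ?_
  filter_upwards [h0, h1] with ω h0 h1 _
  rw [hhe] at h0 h1 ⊢
  simp only [Function.comp_apply, Pi.zero_apply] at h0 h1 ⊢
  rw [min_eq_right h1, max_eq_right h0]

/-- A conditional probability may replace the indicator of the event under the integral of a
function of the conditioning variable. -/
theorem setIntegral_indicator_mul_eq [IsFiniteMeasure P] (hS : Measurable S)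
    {E : Set Ω} (hE : MeasurableSet E) {φ : X → ℝ} (hφ : Measurable φ)
    (hφI : ∀ x, φ x ∈ Set.Icc (0 : ℝ) 1)
    (hφE : ∀ D, MeasurableSet D →
      ∫ ω in S ⁻¹' D, φ (S ω) ∂P = ∫ ω in S ⁻¹' D, E.indicator (fun _ => (1 : ℝ)) ω ∂P)
    {K : X → ℝ} (hK : Measurable K) {c : ℝ} (hc : ∀ x, |K x| ≤ c) {D : Set X}
    (hD : MeasurableSet D) :
    ∫ ω in S ⁻¹' D, K (S ω) * E.indicator (fun _ => (1 : ℝ)) ω ∂P =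
      ∫ ω in S ⁻¹' D, K (S ω) * φ (S ω) ∂P := by
  have hint : Integrable (E.indicator fun _ => (1 : ℝ)) P := (integrable_const 1).indicator hE
  have hφint : Integrable (fun ω => φ (S ω)) P :=
    Integrable.of_bound (hφ.comp hS).aestronglyMeasurable 1 (.of_forall fun ω => by
      rw [Real.norm_of_nonneg (hφI _).1]; exact (hφI _).2)
  have hKS : Measurable[MeasurableSpace.comap S inferInstance] fun ω => K (S ω) :=
    hK.comp (comap_measurable S)
  have hmul : Integrable (fun ω => K (S ω) * E.indicator (fun _ => (1 : ℝ)) ω) P :=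
    hint.bdd_mul (hK.comp hS).aestronglyMeasurable (.of_forall fun ω => hc _)
  have hce : (fun ω => φ (S ω)) =ᵐ[P] condExp (MeasurableSpace.comap S inferInstance) P
      (E.indicator fun _ => (1 : ℝ)) := by
    refine ae_eq_condExp_of_forall_setIntegral_eq hS.comap_le hint
      (fun _ _ _ => hφint.integrableOn) ?_ (hφ.comp (comap_measurable S)).aestronglyMeasurable
    rintro _ ⟨D, hD, rfl⟩ -
    exact hφE D hD
  rw [← setIntegral_condExp hS.comap_le hmul ⟨D, hD, rfl⟩]
  refine setIntegral_congr_ae (hS hD) ?_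
  filter_upwards [hce, condExp_mul_of_stronglyMeasurable_left hKS.stronglyMeasurable hmul hint]
    with ω h1 h2 _
  refine Eq.trans h2 ?_
  simp only [Pi.mul_apply, h1]

end CondExpGiven

/-! ### Means over the fibers of a finite-valued map -/

section FiberMean

variable {Ω α β υ : Type*} [MeasurableSpace Ω] [MeasurableSpace α] [MeasurableSpace β]

/-- The mean of `F (s, ·)` under `μ` conditioned on the fiber `m ⁻¹' {s.2}`. -/
def fiberMean (μ : Measure β) (m : β → υ) (F : (ℝ × υ) × β → ℝ) (s : ℝ × υ) : ℝ :=
  ∫ b, F (s, b) ∂(ProbabilityTheory.cond μ (m ⁻¹' {s.2}))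

theorem abs_fiberMean_le (μ : Measure β) [IsFiniteMeasure μ] (m : β → υ)
    {F : (ℝ × υ) × β → ℝ} {c : ℝ} (hc : ∀ x, |F x| ≤ c) (hc0 : 0 ≤ c) (s : ℝ × υ) :
    |fiberMean μ m F s| ≤ c := by
  unfold fiberMean
  by_cases h : μ (m ⁻¹' {s.2}) = 0
  · rw [cond_eq_zero_of_meas_eq_zero h]
    simpa using hc0
  · have := cond_isProbabilityMeasure h
    simpa using norm_integral_le_of_norm_le_const
      (μ := ProbabilityTheory.cond μ (m ⁻¹' {s.2})) (f := fun b => F (s, b)) (C := c)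
      (.of_forall fun b => hc _)

variable [MeasurableSpace υ] [Finite υ] [MeasurableSingletonClass υ]

theorem measurable_fiberMean (μ : Measure β) [SFinite μ] (m : β → υ)
    {F : (ℝ × υ) × β → ℝ} (hF : Measurable F) :
    Measurable (fiberMean μ m F) := by
  refine measurable_from_prod_countable_left fun u => ?_
  have h : Measurable fun x : ℝ × β => F ((x.1, u), x.2) := by fun_prop
  have : SFinite (ProbabilityTheory.cond μ (m ⁻¹' {u})) := by
    unfold ProbabilityTheory.cond; infer_instance
  exact (h.stronglyMeasurable.integral_prod_right'
    (ν := ProbabilityTheory.cond μ (m ⁻¹' {u}))).measurable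

/-- Averaging over each fiber of `m` does not change the integral. -/
theorem integral_fiber {μ : Measure β} [IsFiniteMeasure μ] {m : β → υ}
    (hm : Measurable m) {G : υ → β → ℝ} (hG : ∀ u, Integrable (G u) μ) :
    ∫ b, G (m b) b ∂μ = ∫ b, (∫ b', G (m b) b' ∂(ProbabilityTheory.cond μ (m ⁻¹' {m b}))) ∂μ := by
  have : Fintype υ := Fintype.ofFinite υ
  have hsum : ∀ K : υ → β → ℝ, (∀ u, Integrable (K u) μ) →
      ∫ b, K (m b) b ∂μ = ∑ u, ∫ b in m ⁻¹' {u}, K u b ∂μ := by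
    intro K hK
    have : ∀ b, K (m b) b = ∑ u, (m ⁻¹' {u}).indicator (K u) b := by
      intro b
      rw [Finset.sum_eq_single (m b)]
      · simp
      · intro u _ hu
        exact Set.indicator_of_notMem (fun h => hu (by simpa using h.symm)) _
      · simp
    simp_rw [this]
    rw [integral_finsetSum _ fun u _ => (hK u).indicator (hm (measurableSet_singleton u))]
    exact Finset.sum_congr rfl fun u _ => integral_indicator (hm (measurableSet_singleton u))
  rw [hsum G hG, hsum (fun u _ => ∫ b', G u b' ∂(ProbabilityTheory.cond μ (m ⁻¹' {u})))
    fun u => integrable_const _]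
  refine Finset.sum_congr rfl fun u _ => ?_
  rw [setIntegral_const, ProbabilityTheory.cond, integral_smul_measure, smul_smul, Measure.real,
    ENNReal.toReal_inv]
  by_cases h : μ (m ⁻¹' {u}) = 0
  · rw [setIntegral_measure_zero _ h, smul_zero]
  · rw [mul_inv_cancel₀ (ENNReal.toReal_ne_zero.mpr ⟨h, measure_ne_top _ _⟩), one_smul]

/-- If `A` and `B` are independent, then the conditional mean given `(A, m B)` of a function of `B`
and a function of `(A, m B)` is the mean over the fiber of `m`. -/
theorem setIntegral_eq_fiberMean {μ : Measure Ω} [IsProbabilityMeasure μ] {A : Ω → α} {B : Ω → β}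
    {m : β → υ} (hA : Measurable A)
    (hB : Measurable B) (hm : Measurable m) (hAB : IndepFun A B μ) {φ : α × υ → ℝ}
    (hφ : Measurable φ) {F : (ℝ × υ) × β → ℝ} (hF : Measurable F) {c : ℝ} (hc : ∀ x, |F x| ≤ c)
    {D : Set (α × υ)} (hD : MeasurableSet D) :
    ∫ ω in (fun ω => (A ω, m (B ω))) ⁻¹' D, F ((φ (A ω, m (B ω)), m (B ω)), B ω) ∂μ =
      ∫ ω in (fun ω => (A ω, m (B ω))) ⁻¹' D,
        fiberMean (μ.map B) m F (φ (A ω, m (B ω)), m (B ω)) ∂μ := by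
  have : IsProbabilityMeasure (μ.map A) := Measure.isProbabilityMeasure_map hA.aemeasurable
  have : IsProbabilityMeasure (μ.map B) := Measure.isProbabilityMeasure_map hB.aemeasurable
  have hfub : ∀ K : (ℝ × υ) × β → ℝ, Measurable K → (∀ x, |K x| ≤ c) →
      ∫ ω in (fun ω => (A ω, m (B ω))) ⁻¹' D, K ((φ (A ω, m (B ω)), m (B ω)), B ω) ∂μ =
        ∫ a, (∫ b, D.indicator (fun x => K ((φ x, x.2), b)) (a, m b) ∂(μ.map B)) ∂(μ.map A) := by
    intro K hK hKc
    have hmeas : Measurable fun p : α × β => D.indicator (fun x => K ((φ x, x.2), p.2))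
        (p.1, m p.2) := by
      have h1 : Measurable fun p : α × β => K ((φ (p.1, m p.2), m p.2), p.2) := by fun_prop
      exact h1.indicator (s := (fun p : α × β => (p.1, m p.2)) ⁻¹' D)
        ((by fun_prop : Measurable fun p : α × β => (p.1, m p.2)) hD)
    rw [← integral_indicator ((by fun_prop : Measurable fun ω => (A ω, m (B ω))) hD)]
    rw [← integral_prod (μ := μ.map A) (ν := μ.map B)
      (fun p : α × β => D.indicator (fun x => K ((φ x, x.2), p.2)) (p.1, m p.2))
      (Integrable.of_bound hmeas.aestronglyMeasurable c (.of_forall fun p => ?_)),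
      ← (indepFun_iff_map_prod_eq_prod_map_map hA.aemeasurable hB.aemeasurable).mp hAB,
      integral_map (hA.prodMk hB).aemeasurable hmeas.aestronglyMeasurable]
    · rfl
    · exact (norm_indicator_le_norm_self _ _).trans (hKc _)
  have hc0 : 0 ≤ c := (abs_nonneg _).trans (hc ((0, m (B (Classical.choice
    (nonempty_of_isProbabilityMeasure μ)))), B (Classical.choice
    (nonempty_of_isProbabilityMeasure μ))))
  rw [hfub F hF hc, hfub (fun x => fiberMean (μ.map B) m F x.1)
    ((measurable_fiberMean _ m hF).comp measurable_fst) fun x => abs_fiberMean_le _ m hc hc0 x.1]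
  refine integral_congr_ae (.of_forall fun a => ?_)
  have hint : ∀ u, Integrable (fun b => D.indicator (fun x => F ((φ x, x.2), b)) (a, u))
      (μ.map B) := by
    intro u
    refine Integrable.of_bound (C := c) (Measurable.aestronglyMeasurable ?_)
      (.of_forall fun p => (norm_indicator_le_norm_self _ _).trans (hc _))
    by_cases h : (a, u) ∈ D
    · simp only [Set.indicator_of_mem h]
      fun_prop
    · simp only [Set.indicator_of_notMem h]
      fun_prop
  refine (integral_fiber hm hint).trans (integral_congr_ae (.of_forall fun b => ?_))
  by_cases h : (a, m b) ∈ D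
  · simp only [Set.indicator_of_mem h, fiberMean]
  · simp only [Set.indicator_of_notMem h, integral_zero]

end FiberMean

/-! ### Conditional independence given the belief -/

section Filter

variable {Ω α β υ ρ : Type*} [MeasurableSpace Ω] [MeasurableSpace α] [MeasurableSpace β]
  [MeasurableSpace υ] [Finite υ] [MeasurableSingletonClass υ] [MeasurableSpace ρ]
  {P : Measure Ω} [IsProbabilityMeasure P] {H : Ω → Fin 2} {A : Ω → α} {B : Ω → β} {m : β → υ}
  {X : Ω → α × υ}

/-- If `A` and `B` are independent given the hypothesis `H`, and `X = (A, m B)` is observed, with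
`φ X` the resulting belief, then the conditional mean given `X` of a function of `H`, `B` and the
state `S = (φ X, m B)` is a function of `S`. -/
theorem exists_state_mean (hH : Measurable H) (hA : Measurable A) (hB : Measurable B)
    (hm : Measurable m) (hX : ∀ ω, X ω = (A ω, m (B ω)))
    (hind : ∀ h, P (H ⁻¹' {h}) ≠ 0 → IndepFun A B (ProbabilityTheory.cond P (H ⁻¹' {h})))
    {φ : α × υ → ℝ} (hφ : Measurable φ) (hφI : ∀ x, φ x ∈ Set.Icc (0 : ℝ) 1)
    (hφH : ∀ D, MeasurableSet D → ∫ ω in X ⁻¹' D, φ (X ω) ∂P =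
      ∫ ω in X ⁻¹' D, (H ⁻¹' {0}).indicator (fun _ => (1 : ℝ)) ω ∂P)
    {F : Fin 2 → (ℝ × υ) × β → ℝ} (hF : ∀ h, Measurable (F h)) {c : ℝ}
    (hc : ∀ h x, |F h x| ≤ c) :
    ∃ w : ℝ × υ → ℝ, Measurable w ∧ (∀ s, |w s| ≤ c) ∧ ∀ D, MeasurableSet D →
      ∫ ω in X ⁻¹' D, F (H ω) ((φ (X ω), (X ω).2), B ω) ∂P =
        ∫ ω in X ⁻¹' D, w (φ (X ω), (X ω).2) ∂P := by
  have hXm : Measurable X := by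
    rw [funext hX]; fun_prop
  have hc0 : 0 ≤ c := by
    obtain ⟨ω⟩ := nonempty_of_isProbabilityMeasure P
    exact (abs_nonneg _).trans (hc 0 ((φ (X ω), (X ω).2), B ω))
  let G : Fin 2 → ℝ × υ → ℝ := fun h =>
    fiberMean ((ProbabilityTheory.cond P (H ⁻¹' {h})).map B) m (F h)
  have hfin : ∀ h, IsFiniteMeasure (ProbabilityTheory.cond P (H ⁻¹' {h})) := fun h => by
    by_cases h0 : P (H ⁻¹' {h}) = 0
    · rw [cond_eq_zero_of_meas_eq_zero h0]; infer_instance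
    · have := cond_isProbabilityMeasure h0
      infer_instance
  have hGm : ∀ h, Measurable (G h) := fun h => measurable_fiberMean _ m (hF h)
  have hGc : ∀ h s, |G h s| ≤ c := fun h s => abs_fiberMean_le _ m (hc h) hc0 s
  have hHm : ∀ h, MeasurableSet (H ⁻¹' {h}) := fun h => hH (measurableSet_singleton h)
  have hS : Measurable fun ω => (φ (X ω), (X ω).2) := by fun_prop
  have hFi : ∀ h, Integrable (fun ω => F h ((φ (X ω), (X ω).2), B ω)) P := fun h =>
    Integrable.of_bound ((hF h).comp (hS.prodMk hB)).aestronglyMeasurable c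
      (.of_forall fun ω => hc _ _)
  have hGi : ∀ h, Integrable (fun ω => G h (φ (X ω), (X ω).2)) P := fun h =>
    Integrable.of_bound ((hGm h).comp hS).aestronglyMeasurable c (.of_forall fun ω => hGc _ _)
  have hFG : ∀ h D, MeasurableSet D →
      ∫ ω in X ⁻¹' D ∩ H ⁻¹' {h}, F h ((φ (X ω), (X ω).2), B ω) ∂P =
        ∫ ω in X ⁻¹' D ∩ H ⁻¹' {h}, G h (φ (X ω), (X ω).2) ∂P := by
    intro h D hD
    by_cases h0 : P (H ⁻¹' {h}) = 0
    · have h1 : P (X ⁻¹' D ∩ H ⁻¹' {h}) = 0 := measure_mono_null Set.inter_subset_right h0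
      rw [setIntegral_measure_zero _ h1, setIntegral_measure_zero _ h1]
    · have := cond_isProbabilityMeasure h0
      have key := setIntegral_eq_fiberMean hA hB hm (hind h h0) hφ (hF h) (hc h) hD
      simp only [← hX] at key
      have hXD : (fun ω => X ω) ⁻¹' D = X ⁻¹' D := rfl
      rw [hXD] at key
      have h2 : ∀ ω, m (B ω) = (X ω).2 := fun ω => by rw [hX]
      simp only [h2] at key
      rw [setIntegral_cond (hXm hD), setIntegral_cond (hXm hD)] at key
      exact mul_left_cancel₀ (ENNReal.toReal_ne_zero.mpr
        ⟨ENNReal.inv_ne_zero.mpr (measure_ne_top P _), ENNReal.inv_ne_top.mpr h0⟩) key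
  -- Beliefs lie in the unit interval; clipping makes the mixture bounded on all of `ℝ × υ`.
  let q : ℝ × υ → ℝ := fun s => max 0 (min 1 s.1)
  have hq0 : ∀ s, 0 ≤ q s := fun s => le_max_left _ _
  have hq1 : ∀ s, q s ≤ 1 := fun s => max_le zero_le_one (min_le_left _ _)
  have hqφ : ∀ x u, q (φ x, u) = φ x := fun x u => by
    simp only [q, min_eq_right (hφI x).2, max_eq_right (hφI x).1]
  refine ⟨fun s => G 1 s + (G 0 s - G 1 s) * q s, by fun_prop, fun s => ?_, fun D hD => ?_⟩
  · have h0 := abs_le.mp (hGc 0 s)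
    have h1 := abs_le.mp (hGc 1 s)
    have h2 := hq0 s
    have h3 := hq1 s
    rw [abs_le]
    constructor <;> nlinarith
  · let I : Ω → ℝ := (H ⁻¹' {0}).indicator fun _ => 1
    have hdec : ∀ K : Fin 2 → Ω → ℝ, (∀ h, Integrable (K h) P) →
        ∫ ω in X ⁻¹' D, K (H ω) ω ∂P =
          ∫ ω in X ⁻¹' D ∩ H ⁻¹' {0}, K 0 ω ∂P + ∫ ω in X ⁻¹' D ∩ H ⁻¹' {1}, K 1 ω ∂P := by
      intro K hK
      have h01 : ∀ ω, K (H ω) ω =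
          (H ⁻¹' {0}).indicator (K 0) ω + (H ⁻¹' {1}).indicator (K 1) ω := by
        intro ω
        by_cases h : H ω = 0
        · simp [h]
        · have h : H ω = 1 := by omega
          simp [h]
      simp only [h01]
      rw [integral_add ((hK 0).indicator (hHm 0)).integrableOn
        ((hK 1).indicator (hHm 1)).integrableOn, setIntegral_indicator (hHm 0),
        setIntegral_indicator (hHm 1)]
    have hGS : ∀ h, Measurable fun x : α × υ => G h (φ x, x.2) := fun h => by fun_prop
    have hpull := setIntegral_indicator_mul_eq hXm (hHm 0) hφ hφI hφH
      (K := fun x => G 0 (φ x, x.2) - G 1 (φ x, x.2)) ((hGS 0).sub (hGS 1)) (c := c + c)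
      (fun x => (abs_sub _ _).trans (add_le_add (hGc _ _) (hGc _ _))) hD
    rw [hdec (fun h ω => F h ((φ (X ω), (X ω).2), B ω)) hFi, hFG 0 D hD, hFG 1 D hD,
      ← hdec (fun h ω => G h (φ (X ω), (X ω).2)) hGi]
    have hI : ∀ ω, G (H ω) (φ (X ω), (X ω).2) = G 1 (φ (X ω), (X ω).2) +
        (G 0 (φ (X ω), (X ω).2) - G 1 (φ (X ω), (X ω).2)) *
          (H ⁻¹' {0}).indicator (fun _ => (1 : ℝ)) ω := by
      intro ω
      by_cases h : H ω = 0
      · simp [h]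
      · have h : H ω = 1 := by omega
        simp [h]
    simp only [hI, hqφ]
    have hKm : AEStronglyMeasurable
        (fun ω => G 0 (φ (X ω), (X ω).2) - G 1 (φ (X ω), (X ω).2)) P :=
      ((hGi 0).sub (hGi 1)).aestronglyMeasurable
    have hKi : Integrable (fun ω => G 0 (φ (X ω), (X ω).2) - G 1 (φ (X ω), (X ω).2)) P :=
      (hGi 0).sub (hGi 1)
    rw [integral_add (hGi 1).integrableOn, integral_add (hGi 1).integrableOn, hpull]
    · refine (hKi.mul_bdd (c := 1) (hφ.comp hXm).aestronglyMeasurable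
        (.of_forall fun ω => ?_)).integrableOn
      rw [Function.comp_apply, Real.norm_of_nonneg (hφI _).1]
      exact (hφI _).2
    · refine (hKi.mul_bdd (c := 1) (measurable_const.indicator (hHm 0)).aestronglyMeasurable
        (.of_forall fun ω => (norm_indicator_le_norm_self _ _).trans (by simp))).integrableOn

/-- The state evolves like a controlled Markov chain: if a further random variable `R = r B` is
observed, then the conditional mean given `X` of a function of the new belief `φ' (X, R)` and of `R`
is a function of the state `(φ X, m B)`. The reason is that the new belief is the conditional
probability of `H = 0` given the state and `R`. -/
theorem exists_state_mean_next (hH : Measurable H) (hA : Measurable A) (hB : Measurable B)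
    (hm : Measurable m) (hX : ∀ ω, X ω = (A ω, m (B ω)))
    (hind : ∀ h, P (H ⁻¹' {h}) ≠ 0 → IndepFun A B (ProbabilityTheory.cond P (H ⁻¹' {h})))
    {φ : α × υ → ℝ} (hφ : Measurable φ) (hφI : ∀ x, φ x ∈ Set.Icc (0 : ℝ) 1)
    (hφH : ∀ D, MeasurableSet D → ∫ ω in X ⁻¹' D, φ (X ω) ∂P =
      ∫ ω in X ⁻¹' D, (H ⁻¹' {0}).indicator (fun _ => (1 : ℝ)) ω ∂P)
    {r : β → ρ} (hr : Measurable r) {φ' : (α × υ) × ρ → ℝ} (hφ' : Measurable φ')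
    (hφI' : ∀ x, φ' x ∈ Set.Icc (0 : ℝ) 1)
    (hφH' : ∀ D, MeasurableSet D →
      ∫ ω in (fun ω => (X ω, r (B ω))) ⁻¹' D, φ' (X ω, r (B ω)) ∂P =
      ∫ ω in (fun ω => (X ω, r (B ω))) ⁻¹' D, (H ⁻¹' {0}).indicator (fun _ => (1 : ℝ)) ω ∂P)
    {f : ℝ × ρ → ℝ} (hf : Measurable f) {c : ℝ} (hc : ∀ x, |f x| ≤ c) :
    ∃ w : ℝ × υ → ℝ, Measurable w ∧ (∀ s, |w s| ≤ c) ∧ ∀ D, MeasurableSet D →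
      ∫ ω in X ⁻¹' D, f (φ' (X ω, r (B ω)), r (B ω)) ∂P =
        ∫ ω in X ⁻¹' D, w (φ (X ω), (X ω).2) ∂P := by
  have hXm : Measurable X := by
    rw [funext hX]; fun_prop
  have hHm : ∀ h, MeasurableSet (H ⁻¹' {h}) := fun h => hH (measurableSet_singleton h)
  have hS : Measurable fun ω => (φ (X ω), (X ω).2) := by fun_prop
  have hR : Measurable fun ω => r (B ω) := hr.comp hB
  obtain ⟨ψ, hψ, hψI, hψH⟩ := exists_condProb_version (P := P) (hS.prodMk hR) (hHm 0)
  have hψi : Integrable (fun ω => ψ ((φ (X ω), (X ω).2), r (B ω))) P :=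
    Integrable.of_bound (hψ.comp (hS.prodMk hR)).aestronglyMeasurable 1 (.of_forall fun ω => by
      rw [Real.norm_of_nonneg (hψI _).1]; exact (hψI _).2)
  have hφi' : Integrable (fun ω => φ' (X ω, r (B ω))) P :=
    Integrable.of_bound (hφ'.comp (hXm.prodMk hR)).aestronglyMeasurable 1
      (.of_forall fun ω => by rw [Real.norm_of_nonneg (hφI' _).1]; exact (hφI' _).2)
  have hIi : Integrable ((H ⁻¹' {0}).indicator (fun _ => (1 : ℝ))) P :=
    (integrable_const 1).indicator (hHm 0)
  let d : Ω → ℝ := fun ω =>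
    (H ⁻¹' {0}).indicator (fun _ => (1 : ℝ)) ω - ψ ((φ (X ω), (X ω).2), r (B ω))
  have hdi : Integrable d P := hIi.sub hψi
  -- On rectangles, the integral of `d` is that of a function `w` of the state, by the previous
  -- theorem; and `w` of the state vanishes, since `ψ` is a conditional probability given the state
  -- and `R`.
  have hrect : ∀ D, MeasurableSet D → ∀ E, MeasurableSet E →
      ∫ ω in X ⁻¹' D ∩ (fun ω => r (B ω)) ⁻¹' E, d ω ∂P = 0 := by
    intro D hD E hE
    let F : Fin 2 → (ℝ × υ) × β → ℝ := fun h x => (r ⁻¹' E).indicator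
      (fun b => (if h = 0 then 1 else 0) - ψ (x.1, r b)) x.2
    have hF : ∀ h, Measurable (F h) := fun h =>
      Measurable.indicator (s := Prod.snd ⁻¹' (r ⁻¹' E))
        (f := fun x : (ℝ × υ) × β => (if h = 0 then 1 else 0) - ψ (x.1, r x.2)) (by fun_prop)
        (measurable_snd (hr hE))
    have hFc : ∀ h x, |F h x| ≤ 1 := by
      intro h x
      refine (norm_indicator_le_norm_self
        (fun b => (if h = 0 then 1 else 0) - ψ (x.1, r b)) x.2).trans ?_
      have := hψI (x.1, r x.2)
      rw [Real.norm_eq_abs, abs_le]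
      split_ifs <;> constructor <;> linarith [this.1, this.2]
    obtain ⟨w, hw, hwc, hwD⟩ := exists_state_mean hH hA hB hm hX hind hφ hφI hφH hF hFc
    have hFd : ∀ ω, F (H ω) ((φ (X ω), (X ω).2), B ω) =
        ((fun ω => r (B ω)) ⁻¹' E).indicator d ω := by
      intro ω
      by_cases hω : r (B ω) ∈ E
      · rw [Set.indicator_of_mem (show ω ∈ (fun ω => r (B ω)) ⁻¹' E from hω)]
        simp only [F, d]
        rw [Set.indicator_of_mem (show B ω ∈ r ⁻¹' E from hω)]
        by_cases h : H ω = 0 <;> simp [h]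
      · rw [Set.indicator_of_notMem (show ω ∉ (fun ω => r (B ω)) ⁻¹' E from hω)]
        exact Set.indicator_of_notMem (show B ω ∉ r ⁻¹' E from hω) _
    simp only [hFd, setIntegral_indicator (hR hE)] at hwD
    have hwi : Integrable (fun ω => w (φ (X ω), (X ω).2)) P :=
      Integrable.of_bound (hw.comp hS).aestronglyMeasurable 1 (.of_forall fun ω => hwc _)
    have hw0 : ∀ᵐ ω ∂P, w (φ (X ω), (X ω).2) = 0 := by
      refine comp_ae_eq_of_forall_setIntegral hS hw measurable_const hwi
        (integrable_const 0) fun D0 hD0 => ?_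
      rw [integral_zero]
      have h1 := hwD ((fun x => (φ x, x.2)) ⁻¹' D0) ((by fun_prop :
        Measurable fun x : α × υ => (φ x, x.2)) hD0)
      refine h1.symm.trans ?_
      have h2 := hψH (D0 ×ˢ E) (hD0.prod hE)
      have h3 : X ⁻¹' ((fun x => (φ x, x.2)) ⁻¹' D0) ∩ (fun ω => r (B ω)) ⁻¹' E =
          (fun ω => ((φ (X ω), (X ω).2), r (B ω))) ⁻¹' D0 ×ˢ E := rfl
      rw [h3, integral_sub hIi.integrableOn hψi.integrableOn, h2, sub_self]
    rw [hwD D hD]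
    exact integral_eq_zero_of_ae (ae_restrict_of_ae hw0)
  have hXR : Measurable fun ω => (X ω, r (B ω)) := hXm.prodMk hR
  have hall : ∀ D, MeasurableSet D → ∫ ω in (fun ω => (X ω, r (B ω))) ⁻¹' D, d ω ∂P = 0 := by
    refine MeasurableSpace.induction_on_inter generateFrom_prod.symm isPiSystem_prod
      (by simp) ?_ ?_ ?_
    · rintro _ ⟨D, hD, E, hE, rfl⟩
      exact hrect D hD E hE
    · intro D hD h
      have huniv : ∫ ω, d ω ∂P = 0 := by
        simpa using hrect Set.univ .univ Set.univ .univ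
      rw [Set.preimage_compl, setIntegral_compl (hXR hD) hdi, huniv, h, sub_zero]
    · intro D hdisj hD h
      rw [Set.preimage_iUnion, integral_iUnion (fun n => hXR (hD n))
        (fun a b hab => (hdisj hab).preimage _) hdi.integrableOn]
      simp [h]
  have hae : ∀ᵐ ω ∂P, φ' (X ω, r (B ω)) = ψ ((φ (X ω), (X ω).2), r (B ω)) := by
    refine comp_ae_eq_of_forall_setIntegral hXR hφ'
      (w' := fun p => ψ ((φ p.1, p.1.2), p.2)) (by fun_prop) hφi' hψi fun D hD => ?_
    have h1 := hall D hD
    rw [integral_sub hIi.integrableOn hψi.integrableOn, sub_eq_zero] at h1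
    rw [hφH' D hD]
    exact h1
  obtain ⟨w, hw, hwc, hwD⟩ := exists_state_mean hH hA hB hm hX hind hφ hφI hφH
    (F := fun _ x => f (ψ (x.1, r x.2), r x.2)) (fun _ => by fun_prop) (c := c) (fun _ x => hc _)
  refine ⟨w, hw, hwc, fun D hD => (setIntegral_congr_ae (hXm hD) ?_).trans (hwD D hD)⟩
  filter_upwards [hae] with ω hω _
  rw [hω]

end Filter

namespace DetectionModel

universe u v

variable {N : ℕ} {Ω : Type u} [MeasurableSpace Ω] {Y : Fin N → Type v}
  [∀ i, MeasurableSpace (Y i)] (M : DetectionModel N Ω Y)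

/-! ### Decisions as functions of the observations -/

theorem measurable_decisionOf (Γ : M.Profile) (t : ℕ) :
    ∀ j, Measurable fun y : ∀ i, ℕ → Y i => M.decisionOf Γ y t j := by
  induction t using Nat.strong_induction_on with
  | _ t ih =>
    intro j
    have hD : ∀ (s : Finset.Ico 1 t) (k : Fin N),
        Measurable fun y : ∀ i, ℕ → Y i => M.decisionOf Γ y s k :=
      fun s k => ih s (Finset.mem_Ico.mp s.2).2 k
    have heq : (fun y : ∀ i, ℕ → Y i => M.decisionOf Γ y t j) = fun y =>
        if ∀ s : Finset.Ico 1 t, M.decisionOf Γ y s j = none then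
          (Γ j).rule t (fun s => y j s, fun k s => M.decisionOf Γ y s k) else none := by
      funext y
      rw [decisionOf]
    rw [heq]
    refine Measurable.ite ?_ ?_ measurable_const
    · rw [Set.ofPred_forall]
      exact MeasurableSet.iInter fun s => hD s j (measurableSet_singleton none)
    · refine ((Γ j).measurable_rule t).comp (Measurable.prodMk ?_ ?_)
      · exact measurable_pi_lambda _ fun s => (measurable_pi_apply _).comp (measurable_pi_apply j)
      · exact measurable_pi_lambda _ fun k => measurable_pi_lambda _ fun s => hD s k

theorem measurable_U (Γ : M.Profile) (t : ℕ) (j : Fin N) : Measurable (M.U Γ t j) :=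
  (M.measurable_decisionOf Γ t j).comp
    (measurable_pi_lambda _ fun i => measurable_pi_lambda _ fun s => M.measurable_obs i s)

theorem measurable_info (Γ : M.Profile) (i : Fin N) (t : ℕ) : Measurable (M.info Γ i t) :=
  Measurable.prodMk (measurable_pi_lambda _ fun s => M.measurable_obs i s)
    (measurable_pi_lambda _ fun k => measurable_pi_lambda _ fun s => M.measurable_U Γ s k)

variable {M}

theorem decisionOf_of_active {Γ : M.Profile} {y : ∀ i, ℕ → Y i} {t : ℕ} {j : Fin N}
    (h : ∀ s ∈ Finset.Ico 1 t, M.decisionOf Γ y s j = none) :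
    M.decisionOf Γ y t j =
      (Γ j).rule t (fun s => y j s, fun k s => M.decisionOf Γ y s k) := by
  have h' : ∀ s : Finset.Ico 1 t, M.decisionOf Γ y s j = none := fun s => h s s.2
  rw [decisionOf, if_pos h']

theorem decisionOf_of_stopped {Γ : M.Profile} {y : ∀ i, ℕ → Y i} {s t : ℕ} {j : Fin N}
    (hs : 1 ≤ s) (hst : s < t) (h : M.decisionOf Γ y s j ≠ none) :
    M.decisionOf Γ y t j = none := by
  rw [decisionOf]
  exact if_neg fun h' => h (h' ⟨s, Finset.mem_Ico.mpr ⟨hs, hst⟩⟩)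

/-- The decisions of sensor `i` influence the other sensors only with a delay of one time step. -/
theorem decisionOf_congr {i : Fin N} {Γ Γ' : M.Profile} (hΓ : ∀ j ≠ i, Γ j = Γ' j)
    {y y' : ∀ j, ℕ → Y j} (hy : ∀ j ≠ i, y j = y' j) {t : ℕ}
    (h : ∀ s ∈ Finset.Ico 1 t, M.decisionOf Γ y s i = M.decisionOf Γ' y' s i) :
    ∀ s ≤ t, ∀ j ≠ i, M.decisionOf Γ y s j = M.decisionOf Γ' y' s j := by
  intro s
  induction s using Nat.strong_induction_on with
  | _ s ih =>
    intro hst j hj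
    have hall : ∀ (r : Finset.Ico 1 s) (k : Fin N),
        M.decisionOf Γ y r k = M.decisionOf Γ' y' r k := by
      intro r k
      have hr := Finset.mem_Ico.mp r.2
      by_cases hk : k = i
      · subst hk
        exact h r (Finset.mem_Ico.mpr ⟨hr.1, hr.2.trans_le hst⟩)
      · exact ih r hr.2 (hr.2.le.trans hst) k hk
    rw [decisionOf, decisionOf.eq_def M Γ' y']
    simp only [hall, hΓ j hj, hy j hj]

theorem withStrategy_self (Γ : M.Profile) (i : Fin N) (g : M.Strategy i) :
    M.withStrategy Γ i g i = g :=
  Function.update_self ..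

theorem withStrategy_of_ne (Γ : M.Profile) {i j : Fin N} (g : M.Strategy i) (h : j ≠ i) :
    M.withStrategy Γ i g j = Γ j :=
  Function.update_of_ne h ..

theorem withStrategy_congr (Γ : M.Profile) {i : Fin N} (g g' : M.Strategy i) (j : Fin N)
    (h : j ≠ i) : M.withStrategy Γ i g j = M.withStrategy Γ i g' j := by
  rw [withStrategy_of_ne Γ g h, withStrategy_of_ne Γ g' h]

variable (M) in
/-- The strategy of sensor `i` that ignores all information: blank before time `t`, and then the
decision `a`. -/
def stopAt (i : Fin N) {t : ℕ} (ht : t ≤ M.T) (a : Fin 2) : M.Strategy i where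
  rule s _ := if s < t then none else some a
  measurable_rule _ := measurable_const
  rule_T _ := by simp [ht]

variable (M) in
/-- The profile in which sensor `i` does not stop before the horizon. -/
def waiting (Γ : M.Profile) (i : Fin N) : M.Profile :=
  M.withStrategy Γ i (M.stopAt i le_rfl 0)

theorem decisionOf_stopAt_of_lt (Γ : M.Profile) (i : Fin N) {t : ℕ} (ht : t ≤ M.T) (a : Fin 2)
    (y : ∀ j, ℕ → Y j) {s : ℕ} (hs : s < t) :
    M.decisionOf (M.withStrategy Γ i (M.stopAt i ht a)) y s i = none := by
  rw [decisionOf, withStrategy_self]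
  simp [stopAt, hs]

theorem decisionOf_stopAt (Γ : M.Profile) (i : Fin N) {t : ℕ} (ht : t ≤ M.T) (a : Fin 2)
    (y : ∀ j, ℕ → Y j) :
    M.decisionOf (M.withStrategy Γ i (M.stopAt i ht a)) y t i = some a := by
  rw [decisionOf_of_active fun s hs =>
    decisionOf_stopAt_of_lt Γ i ht a y (Finset.mem_Ico.mp hs).2, withStrategy_self]
  simp [stopAt]

/-- As long as sensor `i` is active, every sensor decides as if `i` did not stop before the
horizon. -/
theorem decisionOf_eq_waiting {Γ : M.Profile} {i : Fin N} {g : M.Strategy i}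
    {y : ∀ j, ℕ → Y j} {t : ℕ} (ht : t ≤ M.T)
    (h : ∀ s ∈ Finset.Ico 1 t, M.decisionOf (M.withStrategy Γ i g) y s i = none) :
    ∀ s ∈ Finset.Ico 1 t, ∀ j,
      M.decisionOf (M.withStrategy Γ i g) y s j = M.decisionOf (M.waiting Γ i) y s j := by
  have h' : ∀ s ∈ Finset.Ico 1 t, M.decisionOf (M.withStrategy Γ i g) y s i =
      M.decisionOf (M.waiting Γ i) y s i := fun s hs => by
    rw [h s hs, waiting, decisionOf_stopAt_of_lt]
    exact (Finset.mem_Ico.mp hs).2.trans_le ht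
  intro s hs j
  by_cases hj : j = i
  · subst hj
    exact h' s hs
  · exact decisionOf_congr (withStrategy_congr Γ _ _) (fun _ _ => rfl) h' s
      (Finset.mem_Ico.mp hs).2.le j hj

/-- If sensor `i` stops at time `t` with the decision `a`, then every sensor decides as if `i` used
the strategy `stopAt`. -/
theorem decisionOf_eq_stopAt {Γ : M.Profile} {i : Fin N} {g : M.Strategy i}
    {y : ∀ j, ℕ → Y j} {t : ℕ} (ht1 : 1 ≤ t) (ht : t ≤ M.T) {a : Fin 2}
    (h : ∀ s ∈ Finset.Ico 1 t, M.decisionOf (M.withStrategy Γ i g) y s i = none)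
    (ha : M.decisionOf (M.withStrategy Γ i g) y t i = some a) {s : ℕ} (hs : 1 ≤ s) (j : Fin N) :
    M.decisionOf (M.withStrategy Γ i g) y s j =
      M.decisionOf (M.withStrategy Γ i (M.stopAt i ht a)) y s j := by
  have h' : ∀ s, 1 ≤ s → M.decisionOf (M.withStrategy Γ i g) y s i =
      M.decisionOf (M.withStrategy Γ i (M.stopAt i ht a)) y s i := by
    intro s hs
    rcases lt_trichotomy s t with hst | rfl | hst
    · rw [h s (Finset.mem_Ico.mpr ⟨hs, hst⟩), decisionOf_stopAt_of_lt _ _ _ _ _ hst]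
    · rw [ha, decisionOf_stopAt]
    · rw [decisionOf_of_stopped ht1 hst (by simp [ha]),
        decisionOf_of_stopped ht1 hst (by simp [decisionOf_stopAt])]
  by_cases hj : j = i
  · subst hj
    exact h' s hs
  · exact decisionOf_congr (t := s) (withStrategy_congr Γ _ _) (fun _ _ => rfl)
      (fun r hr => h' r (Finset.mem_Ico.mp hr).1) s le_rfl j hj

/-- Under `stopAt`, no decision depends on the observations of sensor `i`. -/
theorem decisionOf_stopAt_congr (Γ : M.Profile) (i : Fin N) {t : ℕ} (ht1 : 1 ≤ t) (ht : t ≤ M.T)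
    (a : Fin 2) {y y' : ∀ j, ℕ → Y j} (hy : ∀ j ≠ i, y j = y' j) {s : ℕ} (hs : 1 ≤ s)
    (j : Fin N) :
    M.decisionOf (M.withStrategy Γ i (M.stopAt i ht a)) y s j =
      M.decisionOf (M.withStrategy Γ i (M.stopAt i ht a)) y' s j := by
  have h' : ∀ s, 1 ≤ s → M.decisionOf (M.withStrategy Γ i (M.stopAt i ht a)) y s i =
      M.decisionOf (M.withStrategy Γ i (M.stopAt i ht a)) y' s i := by
    intro s hs
    rcases lt_trichotomy s t with hst | rfl | hst
    · rw [decisionOf_stopAt_of_lt _ _ _ _ _ hst, decisionOf_stopAt_of_lt _ _ _ _ _ hst]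
    · rw [decisionOf_stopAt, decisionOf_stopAt]
    · rw [decisionOf_of_stopped ht1 hst (by simp [decisionOf_stopAt]),
        decisionOf_of_stopped ht1 hst (by simp [decisionOf_stopAt])]
  by_cases hj : j = i
  · subst hj
    exact h' s hs
  · exact decisionOf_congr (t := s) (fun _ _ => rfl) hy
      (fun r hr => h' r (Finset.mem_Ico.mp hr).1) s le_rfl j hj

/-! ### The cost as a function of finitely many decisions -/

theorem exists_decisionOf_ne_none (Γ : M.Profile) (y : ∀ j, ℕ → Y j) (j : Fin N) :
    ∃ t ∈ Finset.Icc 1 M.T, M.decisionOf Γ y t j ≠ none := by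
  by_contra! h
  refine (Γ j).rule_T (fun s => y j s, fun k s => M.decisionOf Γ y s k) ?_
  rw [← decisionOf_of_active]
  · exact h _ (Finset.mem_Icc.mpr ⟨M.one_le_T, le_rfl⟩)
  · exact fun s hs => h s (Finset.Ico_subset_Icc_self hs)

theorem decisionOf_of_T_lt (Γ : M.Profile) (y : ∀ j, ℕ → Y j) (j : Fin N) {t : ℕ}
    (ht : M.T < t) : M.decisionOf Γ y t j = none := by
  obtain ⟨s, hs, h⟩ := exists_decisionOf_ne_none Γ y j
  exact decisionOf_of_stopped (Finset.mem_Icc.mp hs).1 ((Finset.mem_Icc.mp hs).2.trans_lt ht) h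

variable (M) in
/-- The system cost as a function of the hypothesis `h` and all decisions `d`. -/
def costOf (h : Fin 2) (d : ℕ → Fin N → Decision) : ℝ :=
  M.opCost (fun j => sInf {t : ℕ | 1 ≤ t ∧ d t j ≠ none}) +
    M.termCost h (fun j => d (sInf {t : ℕ | 1 ≤ t ∧ d t j ≠ none}) j)
      (fun j => sInf {t : ℕ | 1 ≤ t ∧ d t j ≠ none})

variable (M) in
/-- The system cost as a function of the hypothesis `h` and the observations `y` of all sensors. -/
def costAt (Γ : M.Profile) (h : Fin 2) (y : ∀ j, ℕ → Y j) : ℝ :=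
  M.costOf h (M.decisionOf Γ y)

theorem costAt_congr {Γ Γ' : M.Profile} {y y' : ∀ j, ℕ → Y j} (h : Fin 2)
    (hd : ∀ s, 1 ≤ s → ∀ j, M.decisionOf Γ y s j = M.decisionOf Γ' y' s j) :
    M.costAt Γ h y = M.costAt Γ' h y' := by
  have hset : ∀ j, {t : ℕ | 1 ≤ t ∧ M.decisionOf Γ y t j ≠ none} =
      {t : ℕ | 1 ≤ t ∧ M.decisionOf Γ' y' t j ≠ none} := fun j => by
    ext t
    exact and_congr_right fun ht => by rw [hd t ht]
  have hmem : ∀ j, 1 ≤ sInf {t : ℕ | 1 ≤ t ∧ M.decisionOf Γ' y' t j ≠ none} := fun j => by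
    obtain ⟨t, ht, h⟩ := exists_decisionOf_ne_none Γ' y' j
    exact (Nat.sInf_mem (s := {t : ℕ | 1 ≤ t ∧ M.decisionOf Γ' y' t j ≠ none})
      ⟨t, (Finset.mem_Icc.mp ht).1, h⟩).1
  unfold costAt costOf
  simp only [hset, fun j => hd _ (hmem j) j]

/-- The decisions up to the horizon determine the cost, so that it takes finitely many values. -/
theorem exists_costAt_eq (Γ : M.Profile) :
    ∃ Φ : Fin 2 × (Finset.Icc 1 M.T → Fin N → Decision) → ℝ, ∀ h y,
      M.costAt Γ h y = Φ (h, fun s j => M.decisionOf Γ y s j) := by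
  refine ⟨fun p => M.costOf p.1 fun t j =>
    if ht : t ∈ Finset.Icc 1 M.T then p.2 ⟨t, ht⟩ j else none, ?_⟩
  intro h y
  have hset : ∀ j, {t : ℕ | 1 ≤ t ∧ M.decisionOf Γ y t j ≠ none} = {t : ℕ | 1 ≤ t ∧
      (if t ∈ Finset.Icc 1 M.T then M.decisionOf Γ y t j else none) ≠ none} := fun j => by
    ext t
    refine and_congr_right fun ht => ?_
    by_cases h1 : t ≤ M.T
    · rw [if_pos (Finset.mem_Icc.mpr ⟨ht, h1⟩)]
    · rw [if_neg fun h => h1 (Finset.mem_Icc.mp h).2, decisionOf_of_T_lt Γ y j (not_le.mp h1)]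
  have hmem : ∀ j, sInf {t : ℕ | 1 ≤ t ∧
      (if t ∈ Finset.Icc 1 M.T then M.decisionOf Γ y t j else none) ≠ none} ∈
        Finset.Icc 1 M.T := fun j => by
    obtain ⟨t, ht, h⟩ := exists_decisionOf_ne_none Γ y j
    have ht' : t ∈ {t : ℕ | 1 ≤ t ∧
      (if t ∈ Finset.Icc 1 M.T then M.decisionOf Γ y t j else none) ≠ none} :=
      ⟨(Finset.mem_Icc.mp ht).1, by rwa [if_pos ht]⟩
    exact Finset.mem_Icc.mpr ⟨(Nat.sInf_mem ⟨t, ht'⟩).1,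
      (Nat.sInf_le ht').trans (Finset.mem_Icc.mp ht).2⟩
  unfold costAt costOf
  simp only [hset, dite_eq_ite]
  congr 2
  funext j
  exact (if_pos (hmem j)).symm

theorem measurable_costAt (Γ : M.Profile) (h : Fin 2) : Measurable (M.costAt Γ h) := by
  obtain ⟨Φ, hΦ⟩ := exists_costAt_eq Γ
  have : M.costAt Γ h = fun y => Φ (h, fun s j => M.decisionOf Γ y s j) := funext (hΦ h)
  rw [this]
  exact (Measurable.of_discrete (f := Φ)).comp (measurable_const.prodMk
    (measurable_pi_lambda _ fun s => measurable_pi_lambda _ fun j =>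
      M.measurable_decisionOf Γ s j))

theorem exists_abs_costAt_le (Γ : M.Profile) : ∃ c, ∀ h y, |M.costAt Γ h y| ≤ c := by
  obtain ⟨Φ, hΦ⟩ := exists_costAt_eq Γ
  obtain ⟨c, hc⟩ := (Set.finite_range fun p => |Φ p|).bddAbove
  exact ⟨c, fun h y => by rw [hΦ]; exact hc ⟨_, rfl⟩⟩

theorem measurable_cost (Γ : M.Profile) : Measurable (M.cost Γ) := by
  have h : Measurable fun p : Fin 2 × (∀ j, ℕ → Y j) => M.costAt Γ p.1 p.2 :=
    measurable_from_prod_countable_right fun h => measurable_costAt Γ h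
  exact h.comp (M.measurable_H.prodMk
    (measurable_pi_lambda _ fun i => measurable_pi_lambda _ fun s => M.measurable_obs i s))

theorem integrable_cost (Γ : M.Profile) (μ : Measure Ω) [IsFiniteMeasure μ] :
    Integrable (M.cost Γ) μ := by
  obtain ⟨c, hc⟩ := exists_abs_costAt_le Γ
  exact Integrable.of_bound (measurable_cost Γ).aestronglyMeasurable c
    (.of_forall fun ω => hc _ _)

instance (M : DetectionModel N Ω Y) : IsProbabilityMeasure M.P := M.isProbabilityMeasure_P

/-! ### The information of an active sensor -/

variable (M) in
/-- The information that sensor `i` would have at time `t` if it did not stop before the horizon.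
It does not depend on the strategy of sensor `i`, and it is the actual information as long as the
sensor is active. -/
def idleInfo (Γ : M.Profile) (i : Fin N) (t : ℕ) : Ω → ObsHist (Y i) t × MsgHist M.edge i t :=
  M.info (M.waiting Γ i) i t

theorem measurable_idleInfo (Γ : M.Profile) (i : Fin N) (t : ℕ) : Measurable (M.idleInfo Γ i t) :=
  M.measurable_info _ i t

/-- The part of the information at time `t` that is available at time `s ≤ t`. -/
def truncate {i : Fin N} {s t : ℕ} (h : s ≤ t) (x : ObsHist (Y i) t × MsgHist M.edge i t) :
    ObsHist (Y i) s × MsgHist M.edge i s :=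
  (fun r => x.1 ⟨r, Finset.Icc_subset_Icc_right h r.2⟩,
    fun k r => x.2 k ⟨r, Finset.Ico_subset_Ico_right h r.2⟩)

theorem measurable_truncate {i : Fin N} {s t : ℕ} (h : s ≤ t) :
    Measurable (truncate h : ObsHist (Y i) t × MsgHist M.edge i t → _) := by
  unfold truncate
  fun_prop

/-- The realizations of the information for which a sensor with strategy `g` is still active. -/
def activeSet {i : Fin N} (g : M.Strategy i) (t : ℕ) :
    Set (ObsHist (Y i) t × MsgHist M.edge i t) :=
  {x | ∀ s : Finset.Ico 1 t, g.rule s (truncate (Finset.mem_Ico.mp s.2).2.le x) = none}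

theorem measurableSet_activeSet {i : Fin N} (g : M.Strategy i) (t : ℕ) :
    MeasurableSet (activeSet g t) := by
  unfold activeSet
  rw [Set.ofPred_forall]
  exact MeasurableSet.iInter fun s =>
    (g.measurable_rule s).comp (measurable_truncate _) (measurableSet_singleton none)

theorem info_eq_idleInfo {Γ : M.Profile} {i : Fin N} {g : M.Strategy i} {t : ℕ} (ht : t ≤ M.T)
    {ω : Ω} (h : ω ∈ M.active (M.withStrategy Γ i g) i t) :
    M.info (M.withStrategy Γ i g) i t ω = M.idleInfo Γ i t ω :=
  Prod.ext rfl (funext fun k => funext fun s => decisionOf_eq_waiting ht h s s.2 k)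

theorem active_anti (Γ : M.Profile) (i : Fin N) {s t : ℕ} (h : s ≤ t) :
    M.active Γ i t ⊆ M.active Γ i s :=
  fun _ hω r hr => hω r (Finset.Ico_subset_Ico_right h hr)

theorem U_eq_rule {Γ : M.Profile} {i : Fin N} {g : M.Strategy i} {t : ℕ} (ht : t ≤ M.T)
    {ω : Ω} (h : ω ∈ M.active (M.withStrategy Γ i g) i t) :
    M.U (M.withStrategy Γ i g) t i ω = g.rule t (M.idleInfo Γ i t ω) := by
  rw [← info_eq_idleInfo ht h]
  refine (decisionOf_of_active h).trans ?_
  rw [withStrategy_self]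
  rfl

theorem active_eq_preimage (Γ : M.Profile) {i : Fin N} (g : M.Strategy i) {t : ℕ} (ht : t ≤ M.T) :
    M.active (M.withStrategy Γ i g) i t = M.idleInfo Γ i t ⁻¹' activeSet g t := by
  ext ω
  constructor
  · intro h s
    have hs := Finset.mem_Ico.mp s.2
    exact (U_eq_rule (hs.2.le.trans ht) (active_anti _ i hs.2.le h)).symm.trans (h s s.2)
  · intro h s
    induction s using Nat.strong_induction_on with
    | _ s ih =>
      intro hs
      have hs' := Finset.mem_Ico.mp hs
      rw [U_eq_rule (hs'.2.le.trans ht) fun r hr => ih r (Finset.mem_Ico.mp hr).2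
        (Finset.Ico_subset_Ico_right hs'.2.le hr)]
      exact h ⟨s, hs⟩

theorem measurableSet_active (Γ : M.Profile) {i : Fin N} (g : M.Strategy i) {t : ℕ}
    (ht : t ≤ M.T) : MeasurableSet (M.active (M.withStrategy Γ i g) i t) := by
  rw [active_eq_preimage Γ g ht]
  exact measurable_idleInfo Γ i t (measurableSet_activeSet g t)

theorem info_preimage_inter_active (Γ : M.Profile) {i : Fin N} (g : M.Strategy i) {t : ℕ}
    (ht : t ≤ M.T) (D : Set (ObsHist (Y i) t × MsgHist M.edge i t)) :
    M.info (M.withStrategy Γ i g) i t ⁻¹' D ∩ M.active (M.withStrategy Γ i g) i t =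
      M.idleInfo Γ i t ⁻¹' (D ∩ activeSet g t) := by
  rw [Set.preimage_inter, ← active_eq_preimage Γ g ht]
  ext ω
  refine and_congr_left fun h => ?_
  rw [Set.mem_preimage, info_eq_idleInfo ht h, Set.mem_preimage]

theorem active_stopAt (Γ : M.Profile) (i : Fin N) {t : ℕ} (ht : t ≤ M.T) (a : Fin 2) {s : ℕ}
    (hs : s ≤ t) : M.active (M.withStrategy Γ i (M.stopAt i ht a)) i s = Set.univ :=
  Set.eq_univ_of_forall fun _ _ hr =>
    decisionOf_stopAt_of_lt Γ i ht a _ ((Finset.mem_Ico.mp hr).2.trans_le hs)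

theorem cost_eq_stopAt {Γ : M.Profile} {i : Fin N} {g : M.Strategy i} {t : ℕ} (ht1 : 1 ≤ t)
    (ht : t ≤ M.T) {ω : Ω} (h : ω ∈ M.active (M.withStrategy Γ i g) i t) {a : Fin 2}
    (ha : g.rule t (M.idleInfo Γ i t ω) = some a) :
    M.cost (M.withStrategy Γ i g) ω = M.cost (M.withStrategy Γ i (M.stopAt i ht a)) ω :=
  costAt_congr _ fun _ hs j =>
    decisionOf_eq_stopAt ht1 ht h ((U_eq_rule ht h).trans ha) hs j

/-! ### The belief and the state of a waiting sensor -/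

theorem measurableSet_H (M : DetectionModel N Ω Y) (h : Fin 2) : MeasurableSet (M.H ⁻¹' {h}) :=
  M.measurable_H (measurableSet_singleton h)

theorem integrable_indicator_H (M : DetectionModel N Ω Y) :
    Integrable ((M.H ⁻¹' {0}).indicator fun _ => (1 : ℝ)) M.P :=
  (integrable_const 1).indicator (M.measurableSet_H 0)

variable (M) in
/-- A version of `P(H = 0 | X)` as a function of the realizations of the information `X` of sensor
`i` at time `t` when it waits. It is a belief under every strategy of the sensor. -/
def belief (Γ : M.Profile) (i : Fin N) (t : ℕ) : ObsHist (Y i) t × MsgHist M.edge i t → ℝ :=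
  (exists_condProb_version (P := M.P) (measurable_idleInfo Γ i t) (M.measurableSet_H 0)).choose

theorem measurable_belief (Γ : M.Profile) (i : Fin N) (t : ℕ) : Measurable (M.belief Γ i t) :=
  (exists_condProb_version (P := M.P) (measurable_idleInfo Γ i t)
    (M.measurableSet_H 0)).choose_spec.1

theorem belief_mem_Icc (Γ : M.Profile) (i : Fin N) (t : ℕ) (x) :
    M.belief Γ i t x ∈ Set.Icc (0 : ℝ) 1 :=
  (exists_condProb_version (P := M.P) (measurable_idleInfo Γ i t)
    (M.measurableSet_H 0)).choose_spec.2.1 x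

theorem setIntegral_belief (Γ : M.Profile) (i : Fin N) (t : ℕ) {D} (hD : MeasurableSet D) :
    ∫ ω in M.idleInfo Γ i t ⁻¹' D, M.belief Γ i t (M.idleInfo Γ i t ω) ∂M.P =
      ∫ ω in M.idleInfo Γ i t ⁻¹' D, (M.H ⁻¹' {0}).indicator (fun _ => (1 : ℝ)) ω ∂M.P :=
  (exists_condProb_version (P := M.P) (measurable_idleInfo Γ i t)
    (M.measurableSet_H 0)).choose_spec.2.2 D hD

theorem isBelief_belief (Γ : M.Profile) {i : Fin N} (g : M.Strategy i) :
    M.IsBelief (M.withStrategy Γ i g) i (M.belief Γ i) := by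
  intro t ht
  have htT := (Finset.mem_Icc.mp ht).2
  refine isCondExpGiven_of_forall_setIntegral (M.measurable_info _ i t) (measurable_belief Γ i t)
    M.integrable_indicator_H ?_ fun D hD => ?_
  · refine (Integrable.of_bound ((measurable_belief Γ i t).comp
      (M.measurable_info _ i t)).aestronglyMeasurable 1 (.of_forall fun ω => ?_)).integrableOn
    rw [Function.comp_apply, Real.norm_of_nonneg (belief_mem_Icc Γ i t _).1]
    exact (belief_mem_Icc Γ i t _).2
  · have hm := measurable_idleInfo Γ i t (hD.inter (measurableSet_activeSet g t))
    rw [info_preimage_inter_active Γ g htT,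
      ← setIntegral_belief Γ i t (hD.inter (measurableSet_activeSet g t))]
    refine setIntegral_congr_fun hm fun ω hω => ?_
    rw [← info_preimage_inter_active Γ g htT] at hω
    rw [info_eq_idleInfo htT hω.2]

/-- Every version of the belief agrees with `belief` as long as the sensor is active. -/
theorem IsBelief.ae_eq_belief {Γ : M.Profile} {i : Fin N} {g : M.Strategy i}
    {π : ∀ t : ℕ, ObsHist (Y i) t × MsgHist M.edge i t → ℝ}
    (hπ : M.IsBelief (M.withStrategy Γ i g) i π) {t : ℕ} (ht : t ∈ Finset.Icc 1 M.T) :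
    ∀ᵐ ω ∂M.P.restrict (M.active (M.withStrategy Γ i g) i t),
      π t (M.idleInfo Γ i t ω) = M.belief Γ i t (M.idleInfo Γ i t ω) := by
  have htT := (Finset.mem_Icc.mp ht).2
  have hA := measurableSet_active Γ g htT
  have h1 := ae_restrict_iff_ae_cond.mpr (hπ t ht).2
  have h2 := ae_restrict_iff_ae_cond.mpr (isBelief_belief Γ g t ht).2
  filter_upwards [h1, h2, ae_restrict_mem hA] with ω h1 h2 hω
  rw [← info_eq_idleInfo htT hω]
  exact h1.trans h2.symm

variable (M) in
/-- The information state of sensor `i` when it waits. -/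
def idleState (Γ : M.Profile) (i : Fin N) (t : ℕ) (ω : Ω) : ℝ × MsgHist M.edge i t :=
  (M.belief Γ i t (M.idleInfo Γ i t ω), (M.idleInfo Γ i t ω).2)

theorem measurable_idleState (Γ : M.Profile) (i : Fin N) (t : ℕ) :
    Measurable (M.idleState Γ i t) :=
  ((measurable_belief Γ i t).comp (measurable_idleInfo Γ i t)).prodMk
    (measurable_idleInfo Γ i t).snd

theorem measurable_state {Γ : M.Profile} {i : Fin N}
    {π : ∀ t : ℕ, ObsHist (Y i) t × MsgHist M.edge i t → ℝ} (hπ : M.IsBelief Γ i π) {t : ℕ}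
    (ht : t ∈ Finset.Icc 1 M.T) : Measurable (M.state Γ i π t) :=
  ((hπ t ht).1.comp (M.measurable_info Γ i t)).prodMk (M.measurable_info Γ i t).snd

theorem IsBelief.state_ae_eq {Γ : M.Profile} {i : Fin N} {g : M.Strategy i}
    {π : ∀ t : ℕ, ObsHist (Y i) t × MsgHist M.edge i t → ℝ}
    (hπ : M.IsBelief (M.withStrategy Γ i g) i π) {t : ℕ} (ht : t ∈ Finset.Icc 1 M.T) :
    ∀ᵐ ω ∂M.P.restrict (M.active (M.withStrategy Γ i g) i t),
      M.state (M.withStrategy Γ i g) i π t ω = M.idleState Γ i t ω := by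
  have htT := (Finset.mem_Icc.mp ht).2
  filter_upwards [hπ.ae_eq_belief ht, ae_restrict_mem (measurableSet_active Γ g htT)] with ω h1 h2
  unfold state idleState
  rw [info_eq_idleInfo htT h2, h1]

/-! ### The Markov property of the state -/

variable (M) in
/-- The observations of all sensors, with those of sensor `i` replaced by a fixed sequence `y`: the
observations of the other sensors, encoded so that decision rules can be applied to them. -/
def others (i : Fin N) (y : ℕ → Y i) (ω : Ω) : ∀ j, ℕ → Y j :=
  Function.update (fun j s => M.obs j s ω) i y

theorem measurable_others (i : Fin N) (y : ℕ → Y i) : Measurable (M.others i y) := by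
  refine measurable_pi_lambda _ fun j => measurable_pi_lambda _ fun s => ?_
  by_cases hj : j = i
  · subst hj
    simp only [others, Function.update_self]
    exact measurable_const
  · simp only [others, Function.update_of_ne hj]
    exact M.measurable_obs j s

/-- Given the hypothesis, the past observations of a sensor are independent of its next observation
and the observations of all other sensors. -/
theorem indepFun_past_next_others (i : Fin N) (y : ℕ → Y i) (t : ℕ) (h : Fin 2)
    (h0 : M.P (M.H ⁻¹' {h}) ≠ 0) :
    IndepFun (fun ω (s : Finset.Icc 1 t) => M.obs i s ω)
      (fun ω => (M.obs i (t + 1) ω, M.others i y ω))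
      (ProbabilityTheory.cond M.P (M.H ⁻¹' {h})) := by
  have := cond_isProbabilityMeasure h0
  set μ := ProbabilityTheory.cond M.P (M.H ⁻¹' {h})
  have hA : Measurable fun ω (s : Finset.Icc 1 t) => M.obs i s ω :=
    measurable_pi_lambda _ fun s => M.measurable_obs i s
  have hY : Measurable (M.obs i (t + 1)) := M.measurable_obs i (t + 1)
  have hZ : Measurable (M.others i y) := measurable_others i y
  have h1 : IndepFun (fun ω (s : Finset.Icc 1 t) => M.obs i s ω) (M.obs i (t + 1)) μ := by
    have := (M.indep_times h h0 i).indepFun_finset (Finset.Icc 1 t) {t + 1} (by simp)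
      (M.measurable_obs i)
    exact this.comp (φ := id) (ψ := fun z : ({t + 1} : Finset ℕ) → Y i => z ⟨t + 1, by simp⟩)
      measurable_id (measurable_pi_apply _)
  have h2 : IndepFun (fun ω (s : ℕ) => M.obs i s ω) (M.others i y) μ := by
    have := (M.indep_sensors h h0).indepFun_finset {i} {i}ᶜ disjoint_compl_right
      fun j => measurable_pi_lambda _ fun s => M.measurable_obs j s
    have hψ : Measurable fun (z : ∀ j : ({i}ᶜ : Finset (Fin N)), ℕ → Y j) (j : Fin N) =>
        if hj : j = i then (hj ▸ y : ℕ → Y j) else z ⟨j, by simpa using hj⟩ := by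
      refine measurable_pi_lambda _ fun j => ?_
      by_cases hj : j = i
      · simp only [hj, dite_true]
        exact measurable_const
      · simp only [hj, dite_false]
        exact measurable_pi_apply _
    have hφ : Measurable fun z : ∀ j : ({i} : Finset (Fin N)), ℕ → Y j => z ⟨i, by simp⟩ :=
      measurable_pi_apply _
    have := this.comp hφ hψ
    refine this.congr (.of_forall fun ω => rfl) (.of_forall fun ω => ?_)
    funext j
    by_cases hj : j = i
    · subst hj
      simp [others]
    · simp [others, hj]
  have h3 : IndepFun (fun ω => ((fun (s : Finset.Icc 1 t) => M.obs i s ω), M.obs i (t + 1) ω))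
      (M.others i y) μ :=
    h2.comp (φ := fun z : ℕ → Y i => ((fun s : Finset.Icc 1 t => z s), z (t + 1))) (ψ := id)
      (by fun_prop) measurable_id
  have h4 : IndepFun (M.obs i (t + 1)) (M.others i y) μ :=
    h3.comp (φ := Prod.snd) (ψ := id) measurable_snd measurable_id
  rw [indepFun_iff_map_prod_eq_prod_map_map hA.aemeasurable (hY.prodMk hZ).aemeasurable,
    (indepFun_iff_map_prod_eq_prod_map_map hY.aemeasurable hZ.aemeasurable).mp h4,
    ← Measure.prodAssoc_prod,
    ← (indepFun_iff_map_prod_eq_prod_map_map hA.aemeasurable hY.aemeasurable).mp h1,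
    ← (indepFun_iff_map_prod_eq_prod_map_map (hA.prodMk hY).aemeasurable hZ.aemeasurable).mp h3,
    Measure.map_map MeasurableEquiv.prodAssoc.measurable ((hA.prodMk hY).prodMk hZ)]
  rfl

variable (M) in
/-- The messages that sensor `i` receives before time `t` if it does not stop before the horizon,
as a function of the observations of all sensors. -/
def idleMsg (Γ : M.Profile) (i : Fin N) (t : ℕ) (y : ∀ j, ℕ → Y j) : MsgHist M.edge i t :=
  fun k s => M.decisionOf (M.waiting Γ i) y s k

theorem measurable_idleMsg (Γ : M.Profile) (i : Fin N) (t : ℕ) :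
    Measurable (M.idleMsg Γ i t) :=
  measurable_pi_lambda _ fun k => measurable_pi_lambda _ fun s =>
    M.measurable_decisionOf (M.waiting Γ i) s k

theorem obs_eq_others {i j : Fin N} (h : j ≠ i) (y : ℕ → Y i) (ω : Ω) :
    (fun s => M.obs j s ω) = M.others i y ω j := by
  rw [others, Function.update_of_ne h]

theorem idleInfo_eq (Γ : M.Profile) (i : Fin N) (y : ℕ → Y i) (t : ℕ) (ω : Ω) :
    M.idleInfo Γ i t ω =
      ((fun s : Finset.Icc 1 t => M.obs i s ω), M.idleMsg Γ i t (M.others i y ω)) :=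
  Prod.ext rfl (funext fun k => funext fun s => decisionOf_stopAt_congr Γ i M.one_le_T le_rfl 0
    (fun _ hj => obs_eq_others hj y ω) (Finset.mem_Ico.mp s.2).1 k)

variable (M) in
/-- `w` is bounded, and `w` of the state is a version of the conditional expectation of `f` given
the information of sensor `i` at time `t` when it waits. -/
def IsStateMean (Γ : M.Profile) (i : Fin N) (t : ℕ) (f : Ω → ℝ)
    (w : ℝ × MsgHist M.edge i t → ℝ) : Prop :=
  Measurable w ∧ (∃ c, ∀ s, |w s| ≤ c) ∧ ∀ D, MeasurableSet D →
    ∫ ω in M.idleInfo Γ i t ⁻¹' D, f ω ∂M.P =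
      ∫ ω in M.idleInfo Γ i t ⁻¹' D, w (M.idleState Γ i t ω) ∂M.P

/-- If sensor `i` stops at time `t`, the cost depends on the hypothesis and the observations of the
other sensors only, so that the belief and the messages suffice to predict it. -/
theorem exists_isStateMean_cost (Γ : M.Profile) (i : Fin N) {t : ℕ} (ht1 : 1 ≤ t) (ht : t ≤ M.T)
    (a : Fin 2) :
    ∃ w, M.IsStateMean Γ i t (M.cost (M.withStrategy Γ i (M.stopAt i ht a))) w := by
  obtain ⟨ω₀⟩ := nonempty_of_isProbabilityMeasure M.P
  -- The value of `y` is irrelevant; the point `ω₀` shows that the observation space is inhabited.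
  let y : ℕ → Y i := fun s => M.obs i s ω₀
  obtain ⟨c, hc⟩ := exists_abs_costAt_le (M.withStrategy Γ i (M.stopAt i ht a))
  obtain ⟨w, hw, hwc, hwD⟩ := exists_state_mean (P := M.P) (H := M.H)
    (A := fun ω (s : Finset.Icc 1 t) => M.obs i s ω)
    (B := fun ω => (M.obs i (t + 1) ω, M.others i y ω)) (m := fun b => M.idleMsg Γ i t b.2)
    (X := M.idleInfo Γ i t) M.measurable_H
    (measurable_pi_lambda _ fun s => M.measurable_obs i s)
    ((M.measurable_obs i (t + 1)).prodMk (measurable_others i y))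
    ((measurable_idleMsg Γ i t).comp measurable_snd) (idleInfo_eq Γ i y t)
    (indepFun_past_next_others i y t) (measurable_belief Γ i t) (belief_mem_Icc Γ i t)
    (fun D hD => setIntegral_belief Γ i t hD)
    (F := fun h x => M.costAt (M.withStrategy Γ i (M.stopAt i ht a)) h x.2.2)
    (fun h => (measurable_costAt _ h).comp (by fun_prop)) (c := c) (fun h x => hc h _)
  refine ⟨w, hw, ⟨c, hwc⟩, fun D hD => (Eq.trans ?_ (hwD D hD))⟩
  congr 1
  funext ω
  exact costAt_congr _ fun s hs j =>
    decisionOf_stopAt_congr Γ i ht1 ht a (fun _ hj => obs_eq_others hj y ω) hs j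

theorem exists_isStateMean_next (Γ : M.Profile) (i : Fin N) (t : ℕ)
    {V : ℝ × MsgHist M.edge i (t + 1) → ℝ} (hV : Measurable V) (hVc : ∃ c, ∀ s, |V s| ≤ c) :
    ∃ w, M.IsStateMean Γ i t (fun ω => V (M.idleState Γ i (t + 1) ω)) w := by
  obtain ⟨ω₀⟩ := nonempty_of_isProbabilityMeasure M.P
  let y : ℕ → Y i := fun s => M.obs i s ω₀
  obtain ⟨c, hc⟩ := hVc
  -- `e` appends the next observation and the next messages to the information.
  let e : (ObsHist (Y i) t × MsgHist M.edge i t) × (Y i × MsgHist M.edge i (t + 1)) →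
      ObsHist (Y i) (t + 1) × MsgHist M.edge i (t + 1) := fun p =>
    (fun s => if h : (s : ℕ) ≤ t then
      p.1.1 ⟨s, Finset.mem_Icc.mpr ⟨(Finset.mem_Icc.mp s.2).1, h⟩⟩ else p.2.1, p.2.2)
  have he : Measurable e := by
    refine Measurable.prodMk (measurable_pi_lambda _ fun s => ?_) (by fun_prop)
    by_cases h : (s : ℕ) ≤ t
    · simp only [h, dite_true]
      fun_prop
    · simp only [h, dite_false]
      fun_prop
  let r : Y i × (∀ j, ℕ → Y j) → Y i × MsgHist M.edge i (t + 1) :=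
    fun b => (b.1, M.idleMsg Γ i (t + 1) b.2)
  have hr : Measurable r :=
    measurable_fst.prodMk ((measurable_idleMsg Γ i (t + 1)).comp measurable_snd)
  have hinfo : ∀ ω, e (M.idleInfo Γ i t ω, r (M.obs i (t + 1) ω, M.others i y ω)) =
      M.idleInfo Γ i (t + 1) ω := by
    intro ω
    rw [idleInfo_eq Γ i y (t + 1)]
    refine Prod.ext (funext fun s => ?_) rfl
    by_cases h : (s : ℕ) ≤ t
    · simp only [e, h, dite_true]
      rfl
    · have hs : (s : ℕ) = t + 1 := by have := (Finset.mem_Icc.mp s.2).2; omega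
      simp only [e, h, dite_false, r]
      rw [hs]
  obtain ⟨w, hw, hwc, hwD⟩ := exists_state_mean_next (P := M.P) (H := M.H)
    (A := fun ω (s : Finset.Icc 1 t) => M.obs i s ω)
    (B := fun ω => (M.obs i (t + 1) ω, M.others i y ω)) (m := fun b => M.idleMsg Γ i t b.2)
    (X := M.idleInfo Γ i t) M.measurable_H
    (measurable_pi_lambda _ fun s => M.measurable_obs i s)
    ((M.measurable_obs i (t + 1)).prodMk (measurable_others i y))
    ((measurable_idleMsg Γ i t).comp measurable_snd) (idleInfo_eq Γ i y t)
    (indepFun_past_next_others i y t) (measurable_belief Γ i t) (belief_mem_Icc Γ i t)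
    (fun D hD => setIntegral_belief Γ i t hD) hr
    (φ' := fun p => M.belief Γ i (t + 1) (e p)) ((measurable_belief Γ i (t + 1)).comp he)
    (fun p => belief_mem_Icc Γ i (t + 1) _)
    (fun D hD => by
      let e' : ObsHist (Y i) (t + 1) × MsgHist M.edge i (t + 1) →
          (ObsHist (Y i) t × MsgHist M.edge i t) × (Y i × MsgHist M.edge i (t + 1)) := fun x =>
        (truncate t.le_succ x, (x.1 ⟨t + 1, by simp⟩, x.2))
      have he' : Measurable e' := (measurable_truncate _).prodMk (by fun_prop)
      have hpre : (fun ω => (M.idleInfo Γ i t ω, r (M.obs i (t + 1) ω, M.others i y ω))) ⁻¹' D =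
          M.idleInfo Γ i (t + 1) ⁻¹' (e' ⁻¹' D) := by
        ext ω
        have : e' (M.idleInfo Γ i (t + 1) ω) =
            (M.idleInfo Γ i t ω, r (M.obs i (t + 1) ω, M.others i y ω)) := by
          refine Prod.ext rfl (Prod.ext rfl ?_)
          rw [idleInfo_eq Γ i y (t + 1)]
        simp only [Set.mem_preimage, this]
      simp only [hinfo]
      rw [hpre]
      exact setIntegral_belief Γ i (t + 1) (he' hD))
    (f := fun p => V (p.1, p.2.2)) (by fun_prop) (c := c) (fun x => hc _)
  refine ⟨w, hw, ⟨c, hwc⟩, fun D hD => (Eq.trans ?_ (hwD D hD))⟩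
  congr 1
  funext ω
  simp only [hinfo, idleState]
  rw [idleInfo_eq Γ i y (t + 1)]

/-! ### A dynamic program -/

variable (M) in
/-- A version of the term of the decision `a` at time `t` in the dynamic program, chosen for
`1 ≤ t ≤ T`; at other times it has no meaning. -/
def stopTerm (Γ : M.Profile) (i : Fin N) (a : Fin 2) (t : ℕ) : ℝ × MsgHist M.edge i t → ℝ :=
  Classical.epsilon fun w => ∃ ht : t ≤ M.T,
    M.IsStateMean Γ i t (M.cost (M.withStrategy Γ i (M.stopAt i ht a))) w

variable (M) in
/-- A version of the term of the blank at time `t` for the value function `V` at time `t + 1`. -/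
def contTerm (Γ : M.Profile) (i : Fin N) (t : ℕ) (V : ℝ × MsgHist M.edge i (t + 1) → ℝ) :
    ℝ × MsgHist M.edge i t → ℝ :=
  Classical.epsilon (M.IsStateMean Γ i t fun ω => V (M.idleState Γ i (t + 1) ω))

variable (M) in
/-- The value function of the dynamic program with the terms `stopTerm` and `contTerm`. -/
def valueFn (Γ : M.Profile) (i : Fin N) (t : ℕ) : ℝ × MsgHist M.edge i t → ℝ := fun x =>
  if _h : t < M.T then
    min (min (M.stopTerm Γ i 0 t x) (M.stopTerm Γ i 1 t x))
      (M.contTerm Γ i t (valueFn Γ i (t + 1)) x)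
  else min (M.stopTerm Γ i 0 t x) (M.stopTerm Γ i 1 t x)
termination_by M.T - t

theorem valueFn_of_lt (Γ : M.Profile) (i : Fin N) {t : ℕ} (ht : t < M.T) :
    M.valueFn Γ i t = fun x => min (min (M.stopTerm Γ i 0 t x) (M.stopTerm Γ i 1 t x))
      (M.contTerm Γ i t (M.valueFn Γ i (t + 1)) x) := by
  funext x
  rw [valueFn, dif_pos ht]

theorem valueFn_T (Γ : M.Profile) (i : Fin N) :
    M.valueFn Γ i M.T = fun x => min (M.stopTerm Γ i 0 M.T x) (M.stopTerm Γ i 1 M.T x) := by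
  funext x
  rw [valueFn, dif_neg (lt_irrefl _)]

theorem isStateMean_stopTerm (Γ : M.Profile) (i : Fin N) {t : ℕ} (ht1 : 1 ≤ t) (ht : t ≤ M.T)
    (a : Fin 2) : M.IsStateMean Γ i t (M.cost (M.withStrategy Γ i (M.stopAt i ht a)))
      (M.stopTerm Γ i a t) := by
  obtain ⟨w, hw⟩ := exists_isStateMean_cost Γ i ht1 ht a
  obtain ⟨_, h⟩ := Classical.epsilon_spec (p := fun w => ∃ ht : t ≤ M.T,
    M.IsStateMean Γ i t (M.cost (M.withStrategy Γ i (M.stopAt i ht a))) w) ⟨w, ht, hw⟩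
  exact h

theorem isStateMean_contTerm (Γ : M.Profile) (i : Fin N) (t : ℕ)
    {V : ℝ × MsgHist M.edge i (t + 1) → ℝ} (hV : Measurable V) (hVc : ∃ c, ∀ s, |V s| ≤ c) :
    M.IsStateMean Γ i t (fun ω => V (M.idleState Γ i (t + 1) ω)) (M.contTerm Γ i t V) :=
  Classical.epsilon_spec (exists_isStateMean_next Γ i t hV hVc)

theorem exists_abs_min_le {X : Type*} {f g : X → ℝ} (hf : ∃ c, ∀ x, |f x| ≤ c)
    (hg : ∃ c, ∀ x, |g x| ≤ c) : ∃ c, ∀ x, |min (f x) (g x)| ≤ c := by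
  obtain ⟨c, hc⟩ := hf
  obtain ⟨d, hd⟩ := hg
  exact ⟨max c d, fun x => abs_min_le_max_abs_abs.trans (max_le_max (hc x) (hd x))⟩

theorem measurable_valueFn_and_bounded (Γ : M.Profile) (i : Fin N) {t : ℕ}
    (ht : t ∈ Finset.Icc 1 M.T) :
    Measurable (M.valueFn Γ i t) ∧ ∃ c, ∀ s, |M.valueFn Γ i t s| ≤ c := by
  obtain ⟨ht1, htT⟩ := Finset.mem_Icc.mp ht
  induction htT using Nat.decreasingInduction with
  | self =>
    have h := isStateMean_stopTerm Γ i ht1 le_rfl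
    rw [valueFn_T]
    exact ⟨(h 0).1.min (h 1).1, exists_abs_min_le (h 0).2.1 (h 1).2.1⟩
  | of_succ t htT ih =>
    obtain ⟨ihm, ihc⟩ := ih (Finset.mem_Icc.mpr ⟨by omega, htT⟩) (by omega)
    have h := isStateMean_stopTerm Γ i ht1 htT.le
    have h' := isStateMean_contTerm Γ i t ihm ihc
    rw [valueFn_of_lt Γ i htT]
    exact ⟨((h 0).1.min (h 1).1).min h'.1,
      exists_abs_min_le (exists_abs_min_le (h 0).2.1 (h 1).2.1) h'.2.1⟩

theorem isStateMean_contTerm_valueFn (Γ : M.Profile) (i : Fin N) {t : ℕ} (htT : t < M.T) :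
    M.IsStateMean Γ i t (fun ω => M.valueFn Γ i (t + 1) (M.idleState Γ i (t + 1) ω))
      (M.contTerm Γ i t (M.valueFn Γ i (t + 1))) := by
  obtain ⟨h, h'⟩ := measurable_valueFn_and_bounded Γ i (t := t + 1)
    (Finset.mem_Icc.mpr ⟨by omega, htT⟩)
  exact isStateMean_contTerm Γ i t h h'

theorem integrable_idleState (Γ : M.Profile) (i : Fin N) (t : ℕ)
    {w : ℝ × MsgHist M.edge i t → ℝ} (hw : Measurable w) (hwc : ∃ c, ∀ s, |w s| ≤ c) :
    Integrable (fun ω => w (M.idleState Γ i t ω)) M.P := by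
  obtain ⟨c, hc⟩ := hwc
  exact Integrable.of_bound (hw.comp (measurable_idleState Γ i t)).aestronglyMeasurable c
    (.of_forall fun ω => hc _)

/-- Conditional means for the waiting sensor are conditional means under every strategy `g`, given
any event on which the sensor is active at time `t` and which its information determines. -/
theorem IsStateMean.isCondExpGiven {Γ : M.Profile} {i : Fin N} {g : M.Strategy i}
    {π : ∀ t : ℕ, ObsHist (Y i) t × MsgHist M.edge i t → ℝ}
    (hπ : M.IsBelief (M.withStrategy Γ i g) i π) {t : ℕ} (ht : t ∈ Finset.Icc 1 M.T)
    {f f' : Ω → ℝ} {w : ℝ × MsgHist M.edge i t → ℝ} (hw : M.IsStateMean Γ i t f w) {B : Set Ω}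
    {E} (hE : MeasurableSet E) (hBE : B = M.idleInfo Γ i t ⁻¹' E)
    (hB : B ⊆ M.active (M.withStrategy Γ i g) i t) (hf' : Integrable f' M.P)
    (hff : ∀ᵐ ω ∂M.P.restrict B, f' ω = f ω) :
    IsCondExpGiven M.P B (M.state (M.withStrategy Γ i g) i π t) f' w := by
  have hBm : MeasurableSet B := hBE ▸ measurable_idleInfo Γ i t hE
  have hst : ∀ᵐ ω ∂M.P.restrict B,
      M.state (M.withStrategy Γ i g) i π t ω = M.idleState Γ i t ω :=
    ae_restrict_of_ae_restrict_of_subset hB (hπ.state_ae_eq ht)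
  have hSm := measurable_state hπ ht
  refine isCondExpGiven_of_forall_setIntegral hSm hw.1 hf' ?_ fun D hD => ?_
  · refine (integrable_idleState Γ i t hw.1 hw.2.1).integrableOn.congr ?_
    filter_upwards [hst] with ω hω
    rw [hω]
  · have hset : (M.state (M.withStrategy Γ i g) i π t ⁻¹' D ∩ B : Set Ω) =ᵐ[M.P]
        (M.idleInfo Γ i t ⁻¹' ((fun x => (M.belief Γ i t x, x.2)) ⁻¹' D ∩ E) : Set Ω) := by
      rw [Set.preimage_inter, ← hBE]
      filter_upwards [(ae_restrict_iff' hBm).mp hst] with ω hω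
      refine propext (and_congr_left fun h => ?_)
      change M.state (M.withStrategy Γ i g) i π t ω ∈ D ↔ M.idleState Γ i t ω ∈ D
      rw [hω h]
    have hDm : MeasurableSet ((fun x => (M.belief Γ i t x, x.2)) ⁻¹' D ∩ E) :=
      (((measurable_belief Γ i t).prodMk measurable_snd) hD).inter hE
    have hcongr : ∀ {f₁ f₂ : Ω → ℝ}, (∀ᵐ ω ∂M.P.restrict B, f₁ ω = f₂ ω) →
        ∫ ω in M.state (M.withStrategy Γ i g) i π t ⁻¹' D ∩ B, f₁ ω ∂M.P =
          ∫ ω in M.idleInfo Γ i t ⁻¹' ((fun x => (M.belief Γ i t x, x.2)) ⁻¹' D ∩ E),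
            f₂ ω ∂M.P := by
      intro f₁ f₂ h
      rw [← setIntegral_congr_set hset]
      exact integral_congr_ae (ae_restrict_of_ae_restrict_of_subset Set.inter_subset_right h)
    rw [hcongr hff, hw.2.2 _ hDm]
    exact hcongr (hst.mono fun ω hω => by rw [hω])

theorem measurableSet_rule {i : Fin N} (g : M.Strategy i) (t : ℕ) (d : Decision) :
    MeasurableSet (g.rule t ⁻¹' {d}) :=
  g.measurable_rule t (measurableSet_singleton d)

theorem active_inter_U_eq (Γ : M.Profile) {i : Fin N} (g : M.Strategy i) {t : ℕ} (ht : t ≤ M.T)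
    (d : Decision) :
    M.active (M.withStrategy Γ i g) i t ∩ {ω | M.U (M.withStrategy Γ i g) t i ω = d} =
      M.idleInfo Γ i t ⁻¹' (activeSet g t ∩ g.rule t ⁻¹' {d}) := by
  rw [Set.preimage_inter, ← active_eq_preimage Γ g ht]
  ext ω
  refine and_congr_right fun h => ?_
  rw [Set.mem_ofPred_eq, U_eq_rule ht h]
  rfl

theorem active_inter_U_none (Γ : M.Profile) (i : Fin N) {t : ℕ} (ht : 1 ≤ t) :
    M.active Γ i t ∩ {ω | M.U Γ t i ω = none} = M.active Γ i (t + 1) := by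
  ext ω
  constructor
  · rintro ⟨h, h'⟩ s hs
    rcases (Nat.lt_succ_iff.mp (Finset.mem_Ico.mp hs).2).lt_or_eq with hst | rfl
    · exact h s (Finset.mem_Ico.mpr ⟨(Finset.mem_Ico.mp hs).1, hst⟩)
    · exact h'
  · exact fun h => ⟨active_anti Γ i t.le_succ h, h t (Finset.mem_Ico.mpr ⟨ht, t.lt_succ_self⟩)⟩

theorem isDynamicProgram_valueFn (Γ : M.Profile) (i : Fin N) :
    M.IsDynamicProgram Γ i (M.stopTerm Γ i)
      (fun t => M.contTerm Γ i t (M.valueFn Γ i (t + 1))) (M.valueFn Γ i) where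
  stop_term t ht a g π hπ := by
    obtain ⟨ht1, htT⟩ := Finset.mem_Icc.mp ht
    have hB := active_inter_U_eq Γ g htT (some a)
    have hE := (measurableSet_activeSet g t).inter (measurableSet_rule g t (some a))
    refine (isStateMean_stopTerm Γ i ht1 htT a).isCondExpGiven hπ ht hE hB Set.inter_subset_left
      (integrable_cost _ _) ?_
    refine (ae_restrict_iff' (hB ▸ measurable_idleInfo Γ i t hE)).mpr (.of_forall ?_)
    rintro ω ⟨h, h'⟩
    exact cost_eq_stopAt ht1 htT h ((U_eq_rule htT h).symm.trans h')
  continue_term t ht g π hπ := by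
    obtain ⟨ht1, htT⟩ := Finset.mem_Ico.mp ht
    have ht' : t + 1 ∈ Finset.Icc 1 M.T := Finset.mem_Icc.mpr ⟨by omega, htT⟩
    obtain ⟨hV, c, hc⟩ := measurable_valueFn_and_bounded Γ i ht'
    refine (isStateMean_contTerm_valueFn Γ i htT).isCondExpGiven hπ
      (Finset.Ico_subset_Icc_self ht)
      ((measurableSet_activeSet g t).inter (measurableSet_rule g t none))
      (active_inter_U_eq Γ g htT.le none) Set.inter_subset_left ?_ ?_
    · exact Integrable.of_bound (hV.comp (measurable_state hπ ht')).aestronglyMeasurable c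
        (.of_forall fun ω => hc _)
    · rw [active_inter_U_none _ i ht1]
      filter_upwards [hπ.state_ae_eq ht'] with ω hω
      rw [hω]
  value_T x := by rw [valueFn_T]
  value t ht x := by rw [valueFn_of_lt Γ i (Finset.mem_Ico.mp ht).2]

/-! ### Uniqueness of the dynamic program -/

theorem active_stopAt_inter (Γ : M.Profile) (i : Fin N) {t : ℕ} (ht : t ≤ M.T) (a : Fin 2) :
    M.active (M.withStrategy Γ i (M.stopAt i ht a)) i t ∩
      {ω | M.U (M.withStrategy Γ i (M.stopAt i ht a)) t i ω = some a} = Set.univ := by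
  rw [active_stopAt Γ i ht a le_rfl, Set.univ_inter]
  exact Set.eq_univ_of_forall fun _ => decisionOf_stopAt Γ i ht a _

theorem active_waiting_inter (Γ : M.Profile) (i : Fin N) {t : ℕ} (ht : t < M.T) :
    M.active (M.waiting Γ i) i t ∩ {ω | M.U (M.waiting Γ i) t i ω = none} = Set.univ := by
  rw [waiting, active_stopAt Γ i le_rfl 0 ht.le, Set.univ_inter]
  exact Set.eq_univ_of_forall fun _ => decisionOf_stopAt_of_lt Γ i le_rfl 0 _ ht

theorem state_stopAt (Γ : M.Profile) (i : Fin N) {t : ℕ} (ht : t ≤ M.T) (a : Fin 2) {s : ℕ}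
    (hs : s ≤ t) (ω : Ω) :
    M.state (M.withStrategy Γ i (M.stopAt i ht a)) i (M.belief Γ i) s ω = M.idleState Γ i s ω := by
  have h : ω ∈ M.active (M.withStrategy Γ i (M.stopAt i ht a)) i s := by
    rw [active_stopAt Γ i ht a hs]; trivial
  unfold state idleState
  rw [info_eq_idleInfo (hs.trans ht) h]

section Uniqueness

variable {Γ : M.Profile} {i : Fin N} {W : Fin 2 → ∀ t : ℕ, ℝ × MsgHist M.edge i t → ℝ}
  {C V : ∀ t : ℕ, ℝ × MsgHist M.edge i t → ℝ}

/-- Versions of the terms are unique at the states of the waiting sensor: under `stopAt` the event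
in the definition of the term is the whole space. -/
theorem IsDynamicProgram.stop_ae_eq (h : M.IsDynamicProgram Γ i W C V) {t : ℕ}
    (ht : t ∈ Finset.Icc 1 M.T) (a : Fin 2) :
    ∀ᵐ ω ∂M.P, W a t (M.idleState Γ i t ω) = M.stopTerm Γ i a t (M.idleState Γ i t ω) := by
  have htT := (Finset.mem_Icc.mp ht).2
  have hb := isBelief_belief Γ (M.stopAt i htT a)
  have h1 := (h.stop_term t ht a _ _ hb).2
  have h2 := ((isDynamicProgram_valueFn Γ i).stop_term t ht a _ _ hb).2
  rw [active_stopAt_inter, cond_univ] at h1 h2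
  filter_upwards [h1, h2] with ω h1 h2
  rw [← state_stopAt Γ i htT a le_rfl]
  exact h1.trans h2.symm

theorem IsDynamicProgram.continue_ae_eq (h : M.IsDynamicProgram Γ i W C V) {t : ℕ}
    (ht : t ∈ Finset.Ico 1 M.T)
    (hV : ∀ᵐ ω ∂M.P, V (t + 1) (M.idleState Γ i (t + 1) ω) =
      M.valueFn Γ i (t + 1) (M.idleState Γ i (t + 1) ω)) :
    ∀ᵐ ω ∂M.P, C t (M.idleState Γ i t ω) =
      M.contTerm Γ i t (M.valueFn Γ i (t + 1)) (M.idleState Γ i t ω) := by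
  have htT := (Finset.mem_Ico.mp ht).2
  have hb := isBelief_belief Γ (M.stopAt i le_rfl 0)
  have h1 := (h.continue_term t ht _ _ hb).2
  have h2 := ((isDynamicProgram_valueFn Γ i).continue_term t ht _ _ hb).2
  have huniv := active_waiting_inter Γ i htT
  unfold waiting at huniv
  rw [huniv, cond_univ] at h1 h2
  simp only [state_stopAt Γ i le_rfl 0 htT, state_stopAt Γ i le_rfl 0 htT.le] at h1 h2
  filter_upwards [h1, h2, condExp_congr_ae (m := MeasurableSpace.comap
    (M.state (M.withStrategy Γ i (M.stopAt i le_rfl 0)) i (M.belief Γ i) t) inferInstance) hV]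
    with ω h1 h2 h3
  exact h1.trans (h3.trans h2.symm)

/-- Any two versions of the value function agree almost surely at the states of the waiting
sensor. -/
theorem IsDynamicProgram.value_ae_eq (h : M.IsDynamicProgram Γ i W C V) {t : ℕ}
    (ht : t ∈ Finset.Icc 1 M.T) :
    ∀ᵐ ω ∂M.P, V t (M.idleState Γ i t ω) = M.valueFn Γ i t (M.idleState Γ i t ω) := by
  obtain ⟨ht1, htT⟩ := Finset.mem_Icc.mp ht
  induction htT using Nat.decreasingInduction with
  | self =>
    filter_upwards [h.stop_ae_eq ht 0, h.stop_ae_eq ht 1] with ω h0 h1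
    rw [h.value_T, h0, h1, valueFn_T]
  | of_succ t htT ih =>
    have ht' := Finset.mem_Ico.mpr ⟨ht1, htT⟩
    filter_upwards [h.stop_ae_eq ht 0, h.stop_ae_eq ht 1, h.continue_ae_eq ht'
      (ih (Finset.mem_Icc.mpr ⟨by omega, htT⟩) (by omega))] with ω h0 h1 h2
    rw [h.value t ht', h0, h1, h2, valueFn_of_lt Γ i htT]

theorem IsDynamicProgram.exists_isMinimizer (h : M.IsDynamicProgram Γ i W C V) :
    ∃ γ, M.IsMinimizer i W C V γ := by
  have hb := isBelief_belief Γ (M.stopAt i le_rfl 0)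
  have hW : ∀ t ∈ Finset.Icc 1 M.T, ∀ a, Measurable (W a t) := fun t ht a =>
    (h.stop_term t ht a _ _ hb).1
  have hV : ∀ t ∈ Finset.Icc 1 M.T, Measurable (V t) := by
    intro t ht
    rcases (Finset.mem_Icc.mp ht).2.lt_or_eq with htT | rfl
    · have ht' := Finset.mem_Ico.mpr ⟨(Finset.mem_Icc.mp ht).1, htT⟩
      rw [funext (h.value t ht')]
      exact ((hW t ht 0).min (hW t ht 1)).min (h.continue_term t ht' _ _ hb).1
    · rw [funext h.value_T]
      exact (hW _ ht 0).min (hW _ ht 1)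
  classical
  refine ⟨fun t x => if W 0 t x = V t x then some 0 else if W 1 t x = V t x then some 1 else none,
    fun t ht => ⟨?_, fun x => ⟨fun a ha => ?_, fun hn => ?_⟩⟩⟩
  · exact Measurable.ite (measurableSet_eq_fun (hW t ht 0) (hV t ht)) measurable_const
      (Measurable.ite (measurableSet_eq_fun (hW t ht 1) (hV t ht)) measurable_const
        measurable_const)
  · beta_reduce at ha
    split_ifs at ha with h0 h1
    · obtain rfl : 0 = a := Option.some.inj ha
      exact h0
    · obtain rfl : 1 = a := Option.some.inj ha
      exact h1
  · beta_reduce at hn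
    split_ifs at hn with h0 h1
    rcases (Finset.mem_Icc.mp ht).2.lt_or_eq with htT | rfl
    · refine ⟨htT, ?_⟩
      have hv := h.value t (Finset.mem_Ico.mpr ⟨(Finset.mem_Icc.mp ht).1, htT⟩) x
      rcases min_choice (min (W 0 t x) (W 1 t x)) (C t x) with h2 | h2
      · rcases min_choice (W 0 t x) (W 1 t x) with h3 | h3
        · exact absurd (by rw [hv, h2, h3]) h0
        · exact absurd (by rw [hv, h2, h3]) h1
      · rw [hv, h2]
    · have hv := h.value_T x
      rcases min_choice (W 0 M.T x) (W 1 M.T x) with h3 | h3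
      · exact absurd (by rw [hv, h3]) h0
      · exact absurd (by rw [hv, h3]) h1

end Uniqueness

/-! ### Verification -/

section Verification

variable {Γ : M.Profile} {i : Fin N}

theorem setIntegral_split_rule (g : M.Strategy i) (t : ℕ) {E} (hE : MeasurableSet E) {f : Ω → ℝ}
    (hf : Integrable f M.P) :
    ∫ ω in M.idleInfo Γ i t ⁻¹' E, f ω ∂M.P =
      ∑ d : Decision, ∫ ω in M.idleInfo Γ i t ⁻¹' (E ∩ g.rule t ⁻¹' {d}), f ω ∂M.P := by
  have hset : M.idleInfo Γ i t ⁻¹' E =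
      ⋃ d : Decision, M.idleInfo Γ i t ⁻¹' (E ∩ g.rule t ⁻¹' {d}) := by
    ext ω
    simp
  rw [hset, integral_iUnion_fintype]
  · exact fun d => measurable_idleInfo Γ i t (hE.inter (measurableSet_rule g t d))
  · intro d d' hd
    refine Set.disjoint_left.mpr fun ω h h' => hd ?_
    exact h.2.symm.trans h'.2
  · exact fun d => hf.integrableOn

theorem setIntegral_cost_stop (g : M.Strategy i) {t : ℕ} (ht1 : 1 ≤ t) (htT : t ≤ M.T) {E}
    (hE : MeasurableSet E) (hEA : E ⊆ activeSet g t) (a : Fin 2) :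
    ∫ ω in M.idleInfo Γ i t ⁻¹' (E ∩ g.rule t ⁻¹' {some a}), M.cost (M.withStrategy Γ i g) ω ∂M.P =
      ∫ ω in M.idleInfo Γ i t ⁻¹' (E ∩ g.rule t ⁻¹' {some a}),
        M.stopTerm Γ i a t (M.idleState Γ i t ω) ∂M.P := by
  have hm := hE.inter (measurableSet_rule g t (some a))
  rw [← (isStateMean_stopTerm Γ i ht1 htT a).2.2 _ hm]
  refine setIntegral_congr_fun (measurable_idleInfo Γ i t hm) fun ω hω => ?_
  exact cost_eq_stopAt ht1 htT (by rw [active_eq_preimage Γ g htT]; exact hEA hω.1) hω.2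

/-- The information for which a sensor goes on at time `t`, as a set of realizations of its
information at time `t + 1`. -/
theorem exists_next_activeSet (Γ : M.Profile) (g : M.Strategy i) {t : ℕ} {E}
    (hE : MeasurableSet E) (hEA : E ⊆ activeSet g t) :
    ∃ E', MeasurableSet E' ∧ E' ⊆ activeSet g (t + 1) ∧
      M.idleInfo Γ i t ⁻¹' (E ∩ g.rule t ⁻¹' {none}) = M.idleInfo Γ i (t + 1) ⁻¹' E' := by
  refine ⟨truncate t.le_succ ⁻¹' (E ∩ g.rule t ⁻¹' {none}), measurable_truncate _
    (hE.inter (measurableSet_rule g t none)), ?_, rfl⟩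
  rintro x ⟨hx, hx'⟩ ⟨s, hs⟩
  rcases (Nat.lt_succ_iff.mp (Finset.mem_Ico.mp hs).2).lt_or_eq with hst | rfl
  · exact hEA hx ⟨s, Finset.mem_Ico.mpr ⟨(Finset.mem_Ico.mp hs).1, hst⟩⟩
  · exact hx'

theorem valueFn_le_stopTerm (Γ : M.Profile) (i : Fin N) {t : ℕ} (htT : t ≤ M.T) (a : Fin 2)
    (x : ℝ × MsgHist M.edge i t) : M.valueFn Γ i t x ≤ M.stopTerm Γ i a t x := by
  have h : min (M.stopTerm Γ i 0 t x) (M.stopTerm Γ i 1 t x) ≤ M.stopTerm Γ i a t x := by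
    fin_cases a
    · exact min_le_left _ _
    · exact min_le_right _ _
  rcases htT.lt_or_eq with htT | rfl
  · rw [valueFn_of_lt Γ i htT]
    exact (min_le_left _ _).trans h
  · rw [valueFn_T]
    exact h

theorem setIntegral_contTerm {t : ℕ} (htT : t < M.T) {E} (hE : MeasurableSet E) {E'}
    (hEE' : M.idleInfo Γ i t ⁻¹' E = M.idleInfo Γ i (t + 1) ⁻¹' E') :
    ∫ ω in M.idleInfo Γ i (t + 1) ⁻¹' E',
        M.valueFn Γ i (t + 1) (M.idleState Γ i (t + 1) ω) ∂M.P =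
      ∫ ω in M.idleInfo Γ i t ⁻¹' E,
        M.contTerm Γ i t (M.valueFn Γ i (t + 1)) (M.idleState Γ i t ω) ∂M.P := by
  rw [← hEE', ← (isStateMean_contTerm_valueFn Γ i htT).2.2 E hE]

theorem integrable_valueFn (Γ : M.Profile) (i : Fin N) {t : ℕ} (ht : t ∈ Finset.Icc 1 M.T) :
    Integrable (fun ω => M.valueFn Γ i t (M.idleState Γ i t ω)) M.P :=
  integrable_idleState Γ i t (measurable_valueFn_and_bounded Γ i ht).1
    (measurable_valueFn_and_bounded Γ i ht).2

theorem preimage_rule_T_none (g : M.Strategy i) : g.rule M.T ⁻¹' {none} = ∅ :=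
  Set.eq_empty_of_forall_notMem fun x hx => g.rule_T x hx

/-- The value function is a lower bound of the conditional expected cost under every strategy. -/
theorem setIntegral_valueFn_le (g : M.Strategy i) {t : ℕ} (ht : t ∈ Finset.Icc 1 M.T) {E}
    (hE : MeasurableSet E) (hEA : E ⊆ activeSet g t) :
    ∫ ω in M.idleInfo Γ i t ⁻¹' E, M.valueFn Γ i t (M.idleState Γ i t ω) ∂M.P ≤
      ∫ ω in M.idleInfo Γ i t ⁻¹' E, M.cost (M.withStrategy Γ i g) ω ∂M.P := by
  obtain ⟨ht1, htT⟩ := Finset.mem_Icc.mp ht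
  have hterm : ∀ t, 1 ≤ t → t ≤ M.T → ∀ E, MeasurableSet E → E ⊆ activeSet g t → ∀ a,
      ∫ ω in M.idleInfo Γ i t ⁻¹' (E ∩ g.rule t ⁻¹' {some a}),
          M.valueFn Γ i t (M.idleState Γ i t ω) ∂M.P ≤
        ∫ ω in M.idleInfo Γ i t ⁻¹' (E ∩ g.rule t ⁻¹' {some a}),
          M.cost (M.withStrategy Γ i g) ω ∂M.P := by
    intro t ht1 htT E hE hEA a
    have hs := isStateMean_stopTerm Γ i ht1 htT a
    rw [setIntegral_cost_stop g ht1 htT hE hEA a]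
    exact setIntegral_mono (integrable_valueFn Γ i (Finset.mem_Icc.mpr ⟨ht1, htT⟩)).integrableOn
      (integrable_idleState Γ i t hs.1 hs.2.1).integrableOn
      fun ω => valueFn_le_stopTerm Γ i htT a _
  induction htT using Nat.decreasingInduction with
  | self =>
    rw [setIntegral_split_rule g M.T hE (integrable_valueFn Γ i ht),
      setIntegral_split_rule g M.T hE (integrable_cost _ _)]
    refine Finset.sum_le_sum fun d _ => ?_
    cases d with
    | none => simp [preimage_rule_T_none]
    | some a => exact hterm _ ht1 le_rfl E hE hEA a
  | of_succ t htT ih =>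
    rw [setIntegral_split_rule g t hE (integrable_valueFn Γ i ht),
      setIntegral_split_rule g t hE (integrable_cost _ _)]
    refine Finset.sum_le_sum fun d _ => ?_
    cases d with
    | none =>
      obtain ⟨E', hE', hEA', hEE'⟩ := exists_next_activeSet Γ g hE hEA
      have hc := isStateMean_contTerm_valueFn Γ i htT
      have h1 := ih (Finset.mem_Icc.mpr ⟨by omega, htT⟩) hE' hEA' (by omega)
      rw [setIntegral_contTerm htT (hE.inter (measurableSet_rule g t none)) hEE', ← hEE'] at h1
      refine le_trans ?_ h1
      refine setIntegral_mono (integrable_valueFn Γ i ht).integrableOn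
        (integrable_idleState Γ i t hc.1 hc.2.1).integrableOn fun ω => ?_
      simp only [valueFn_of_lt Γ i htT]
      exact min_le_right _ _
    | some a => exact hterm t ht1 htT.le E hE hEA a

/-- From time `t` on, almost surely, the strategy `g` only takes decisions whose terms attain the
minimum in the value function. -/
def AttainsFrom (Γ : M.Profile) (i : Fin N) (t : ℕ) (g : M.Strategy i) : Prop :=
  ∀ s ∈ Finset.Icc t M.T, ∀ᵐ ω ∂M.P.restrict (M.active (M.withStrategy Γ i g) i s),
    (∀ a, g.rule s (M.idleInfo Γ i s ω) = some a →
      M.stopTerm Γ i a s (M.idleState Γ i s ω) = M.valueFn Γ i s (M.idleState Γ i s ω)) ∧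
    (g.rule s (M.idleInfo Γ i s ω) = none →
      M.contTerm Γ i s (M.valueFn Γ i (s + 1)) (M.idleState Γ i s ω) =
        M.valueFn Γ i s (M.idleState Γ i s ω))

/-- The lower bound is attained by strategies that choose minimizing decisions. -/
theorem AttainsFrom.setIntegral_eq {g : M.Strategy i} {t : ℕ} (hg : AttainsFrom Γ i t g)
    (ht : t ∈ Finset.Icc 1 M.T) {E} (hE : MeasurableSet E) (hEA : E ⊆ activeSet g t) :
    ∫ ω in M.idleInfo Γ i t ⁻¹' E, M.cost (M.withStrategy Γ i g) ω ∂M.P =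
      ∫ ω in M.idleInfo Γ i t ⁻¹' E, M.valueFn Γ i t (M.idleState Γ i t ω) ∂M.P := by
  obtain ⟨ht1, htT⟩ := Finset.mem_Icc.mp ht
  have hae : ∀ t, t ≤ M.T → AttainsFrom Γ i t g → ∀ E, MeasurableSet E → E ⊆ activeSet g t →
      ∀ᵐ ω ∂M.P, ω ∈ M.idleInfo Γ i t ⁻¹' E →
        (∀ a, g.rule t (M.idleInfo Γ i t ω) = some a →
          M.stopTerm Γ i a t (M.idleState Γ i t ω) = M.valueFn Γ i t (M.idleState Γ i t ω)) ∧
        (g.rule t (M.idleInfo Γ i t ω) = none →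
          M.contTerm Γ i t (M.valueFn Γ i (t + 1)) (M.idleState Γ i t ω) =
            M.valueFn Γ i t (M.idleState Γ i t ω)) := by
    intro t htT hg E hE hEA
    have h := (ae_restrict_iff' (measurableSet_active Γ g htT)).mp
      (hg t (Finset.mem_Icc.mpr ⟨le_rfl, htT⟩))
    filter_upwards [h] with ω h hω
    exact h (by rw [active_eq_preimage Γ g htT]; exact hEA hω)
  have hterm : ∀ t, 1 ≤ t → t ≤ M.T → AttainsFrom Γ i t g → ∀ E, MeasurableSet E →
      E ⊆ activeSet g t → ∀ a,
      ∫ ω in M.idleInfo Γ i t ⁻¹' (E ∩ g.rule t ⁻¹' {some a}),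
          M.cost (M.withStrategy Γ i g) ω ∂M.P =
        ∫ ω in M.idleInfo Γ i t ⁻¹' (E ∩ g.rule t ⁻¹' {some a}),
          M.valueFn Γ i t (M.idleState Γ i t ω) ∂M.P := by
    intro t ht1 htT hg E hE hEA a
    rw [setIntegral_cost_stop g ht1 htT hE hEA a]
    refine setIntegral_congr_ae
      (measurable_idleInfo Γ i t (hE.inter (measurableSet_rule g t (some a)))) ?_
    filter_upwards [hae t htT hg E hE hEA] with ω h hω
    exact (h hω.1).1 a hω.2
  induction htT using Nat.decreasingInduction with
  | self =>
    rw [setIntegral_split_rule g M.T hE (integrable_valueFn Γ i ht),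
      setIntegral_split_rule g M.T hE (integrable_cost _ _)]
    refine Finset.sum_congr rfl fun d _ => ?_
    cases d with
    | none => simp [preimage_rule_T_none]
    | some a => exact hterm _ ht1 le_rfl hg E hE hEA a
  | of_succ t htT ih =>
    rw [setIntegral_split_rule g t hE (integrable_valueFn Γ i ht),
      setIntegral_split_rule g t hE (integrable_cost _ _)]
    refine Finset.sum_congr rfl fun d _ => ?_
    cases d with
    | none =>
      obtain ⟨E', hE', hEA', hEE'⟩ := exists_next_activeSet Γ g hE hEA
      have hm := hE.inter (measurableSet_rule g t none)
      have hg' : AttainsFrom Γ i (t + 1) g := fun s hs =>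
        hg s (Finset.Icc_subset_Icc_left t.le_succ hs)
      have h1 := ih hg' (Finset.mem_Icc.mpr ⟨by omega, htT⟩) hE' hEA' (by omega)
      rw [setIntegral_contTerm htT hm hEE', ← hEE'] at h1
      refine h1.trans (setIntegral_congr_ae (measurable_idleInfo Γ i t hm) ?_)
      filter_upwards [hae t htT.le hg E hE hEA] with ω h hω
      exact (h hω.1).2 hω.2
    | some a => exact hterm t ht1 htT.le hg E hE hEA a

theorem AttainsFrom.isOptimal {g : M.Strategy i} (hg : AttainsFrom Γ i 1 g) :
    M.IsOptimal Γ i g := by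
  intro g'
  have h1 : 1 ∈ Finset.Icc 1 M.T := Finset.mem_Icc.mpr ⟨le_rfl, M.one_le_T⟩
  have huniv : ∀ g : M.Strategy i, Set.univ ⊆ activeSet g 1 := fun g x _ s =>
    absurd (Finset.mem_Ico.mp s.2) (by omega)
  have h := (hg.setIntegral_eq h1 .univ (huniv g)).trans_le
    (setIntegral_valueFn_le g' h1 .univ (huniv g'))
  simpa [expectedCost] using h

theorem activeSet_congr {g g' : M.Strategy i} {t : ℕ}
    (h : ∀ s ∈ Finset.Ico 1 t, g'.rule s = g.rule s) : activeSet g' t = activeSet g t := by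
  ext x
  exact forall_congr' fun s => by rw [h s s.2]

theorem AttainsFrom.isOptimalFrom {g : M.Strategy i} {t : ℕ} (hg : AttainsFrom Γ i t g)
    (ht : t ∈ Finset.Icc 1 M.T) : M.IsOptimalFrom Γ i t g := by
  intro g' hg'
  have htT := (Finset.mem_Icc.mp ht).2
  have hact : activeSet g' t = activeSet g t := activeSet_congr hg'
  have hA : M.active (M.withStrategy Γ i g') i t = M.active (M.withStrategy Γ i g) i t := by
    rw [active_eq_preimage Γ g' htT, active_eq_preimage Γ g htT, hact]
  have hAm := measurableSet_active Γ g htT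
  obtain ⟨hVm, hVc⟩ := measurable_valueFn_and_bounded Γ i ht
  set v : ObsHist (Y i) t × MsgHist M.edge i t → ℝ := fun x =>
    M.valueFn Γ i t (M.belief Γ i t x, x.2)
  have hv : Measurable v := hVm.comp ((measurable_belief Γ i t).prodMk measurable_snd)
  have hvi : Integrable (fun ω => v (M.idleInfo Γ i t ω)) M.P := integrable_valueFn Γ i ht
  have hinfo : ∀ g : M.Strategy i, ∀ ω ∈ M.active (M.withStrategy Γ i g) i t,
      M.info (M.withStrategy Γ i g) i t ω = M.idleInfo Γ i t ω := fun g ω h =>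
    info_eq_idleInfo htT h
  have hcongr : ∀ (g : M.Strategy i) (w : ObsHist (Y i) t × MsgHist M.edge i t → ℝ) {D},
      MeasurableSet D →
      ∫ ω in M.info (M.withStrategy Γ i g) i t ⁻¹' D ∩ M.active (M.withStrategy Γ i g) i t,
          w (M.info (M.withStrategy Γ i g) i t ω) ∂M.P =
        ∫ ω in M.idleInfo Γ i t ⁻¹' (D ∩ activeSet g t), w (M.idleInfo Γ i t ω) ∂M.P := by
    intro g w D hD
    rw [← info_preimage_inter_active Γ g htT]
    exact setIntegral_congr_fun ((M.measurable_info _ i t hD).inter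
      (measurableSet_active Γ g htT)) fun ω hω => by simp only [hinfo g ω hω.2]
  have h1 : IsCondExpGiven M.P (M.active (M.withStrategy Γ i g) i t)
      (M.info (M.withStrategy Γ i g) i t) (M.cost (M.withStrategy Γ i g)) v := by
    refine isCondExpGiven_of_forall_setIntegral (M.measurable_info _ i t) hv
      (integrable_cost _ _) ?_ fun D hD => ?_
    · exact hvi.integrableOn.congr_fun (fun ω hω => by simp only [hinfo g ω hω]) hAm
    · rw [hcongr g v hD, info_preimage_inter_active Γ g htT]
      exact (hg.setIntegral_eq ht (hD.inter (measurableSet_activeSet g t))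
        Set.inter_subset_right).symm
  -- The conditional expected cost of `g'` as a function `k` of its information.
  obtain ⟨k, hk, hke⟩ := (stronglyMeasurable_condExp
    (m := MeasurableSpace.comap (M.info (M.withStrategy Γ i g') i t) inferInstance)
    (μ := ProbabilityTheory.cond M.P (M.active (M.withStrategy Γ i g') i t))
    (f := M.cost (M.withStrategy Γ i g'))).measurable.exists_eq_measurable_comp
  have h2 : IsCondExpGiven M.P (M.active (M.withStrategy Γ i g') i t)
      (M.info (M.withStrategy Γ i g') i t) (M.cost (M.withStrategy Γ i g')) k :=
    ⟨hk, .of_eq hke.symm⟩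
  have hki : IntegrableOn (fun ω => k (M.idleInfo Γ i t ω))
      (M.active (M.withStrategy Γ i g) i t) M.P := by
    rw [← hA]
    exact h2.integrableOn.congr_fun (fun ω hω => by simp only [hinfo g' ω hω]) (hA ▸ hAm)
  have hle := comp_ae_le_of_forall_setIntegral
    (P := M.P.restrict (M.active (M.withStrategy Γ i g) i t))
    (measurable_idleInfo Γ i t) hv hk hvi.integrableOn hki fun D hD => by
      have hD' := hD.inter (measurableSet_activeSet g' t)
      rw [Measure.restrict_restrict (measurable_idleInfo Γ i t hD), ← hA,
        active_eq_preimage Γ g' htT, ← Set.preimage_inter, ← hcongr g' k hD,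
        h2.setIntegral_eq (M.measurable_info _ i t) (integrable_cost _ _) hD,
        info_preimage_inter_active Γ g' htT]
      exact setIntegral_valueFn_le g' ht hD' Set.inter_subset_right
  rw [hA] at h2 ⊢
  filter_upwards [h1.2, h2.2, ae_restrict_iff_ae_cond.mp hle,
    ae_restrict_iff_ae_cond.mp (ae_restrict_mem hAm)] with ω h1 h2 h3 hω
  rw [← h1, ← h2, hinfo g ω hω, hinfo g' ω (hA ▸ hω)]
  exact h3

/-- A strategy that decides by a selection of minimizers of any version of the dynamic program, for
any version of its belief, takes minimizing decisions for `valueFn`. -/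
theorem FollowsFrom.attainsFrom {W : Fin 2 → ∀ t : ℕ, ℝ × MsgHist M.edge i t → ℝ}
    {C V : ∀ t : ℕ, ℝ × MsgHist M.edge i t → ℝ} (h : M.IsDynamicProgram Γ i W C V)
    {γ : ∀ t : ℕ, ℝ × MsgHist M.edge i t → Decision} (hγ : M.IsMinimizer i W C V γ)
    {t : ℕ} (ht : 1 ≤ t) {g : M.Strategy i}
    {π : ∀ t : ℕ, ObsHist (Y i) t × MsgHist M.edge i t → ℝ}
    (hπ : M.IsBelief (M.withStrategy Γ i g) i π) (hg : M.FollowsFrom i t g π γ) :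
    AttainsFrom Γ i t g := by
  intro s hs
  have hs' : s ∈ Finset.Icc 1 M.T := Finset.Icc_subset_Icc_left ht hs
  have hV := h.value_ae_eq hs'
  have hC : ∀ᵐ ω ∂M.P, s < M.T → C s (M.idleState Γ i s ω) =
      M.contTerm Γ i s (M.valueFn Γ i (s + 1)) (M.idleState Γ i s ω) := by
    by_cases hsT : s < M.T
    · filter_upwards [h.continue_ae_eq (Finset.mem_Ico.mpr ⟨(Finset.mem_Icc.mp hs').1, hsT⟩)
        (h.value_ae_eq (Finset.mem_Icc.mpr ⟨by omega, hsT⟩))] with ω hω _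
      exact hω
    · exact .of_forall fun _ hsT' => absurd hsT' hsT
  filter_upwards [hπ.ae_eq_belief hs', ae_restrict_of_ae hV, ae_restrict_of_ae hC,
    ae_restrict_of_ae (h.stop_ae_eq hs' 0), ae_restrict_of_ae (h.stop_ae_eq hs' 1)]
    with ω hπω hV hC h0 h1
  have hrule : g.rule s (M.idleInfo Γ i s ω) = γ s (M.idleState Γ i s ω) := by
    rw [hg s hs, hπω]
    rfl
  obtain ⟨hmin, hmin'⟩ := (hγ s hs').2 (M.idleState Γ i s ω)
  rw [hrule, ← hV]
  refine ⟨fun a ha => ?_, fun hn => ?_⟩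
  · rw [← hmin a ha]
    fin_cases a
    · exact h0.symm
    · exact h1.symm
  · rw [← (hmin' hn).2, hC (hmin' hn).1]

/-- Since `belief` does not depend on the strategy, there is no circularity in a strategy that
decides by `γ` and its own belief. -/
theorem exists_followsFrom {W : Fin 2 → ∀ t : ℕ, ℝ × MsgHist M.edge i t → ℝ}
    {C V : ∀ t : ℕ, ℝ × MsgHist M.edge i t → ℝ}
    {γ : ∀ t : ℕ, ℝ × MsgHist M.edge i t → Decision} (hγ : M.IsMinimizer i W C V γ) :
    ∃ g : M.Strategy i, M.FollowsFrom i 1 g (M.belief Γ i) γ := by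
  classical
  have hT : M.T ∈ Finset.Icc 1 M.T := Finset.mem_Icc.mpr ⟨M.one_le_T, le_rfl⟩
  refine ⟨⟨fun t x => if t ∈ Finset.Icc 1 M.T then γ t (M.belief Γ i t x, x.2) else none,
    fun t => ?_, fun x => ?_⟩, fun t ht x => if_pos ht⟩
  · by_cases ht : t ∈ Finset.Icc 1 M.T
    · simp only [ht, if_true]
      exact (hγ t ht).1.comp ((measurable_belief Γ i t).prodMk measurable_snd)
    · simp only [ht, if_false]
      exact measurable_const
  · rw [if_pos hT]
    exact fun hn => lt_irrefl _ (((hγ M.T hT).2 _).2 hn).1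

end Verification

end DetectionModel

end SeqDetect

end

theorem theorem1 {N : ℕ} {Ω : Type*} [MeasurableSpace Ω] {Y : Fin N → Type*}
    [∀ i, MeasurableSpace (Y i)] (M : SeqDetect.DetectionModel N Ω Y)
    (Γ : M.Profile) (i : Fin N) :
    (∃ W C V, M.IsDynamicProgram Γ i W C V) ∧
    ∀ W C V, M.IsDynamicProgram Γ i W C V →
      (∃ γ, M.IsMinimizer i W C V γ) ∧
      ∀ γ, M.IsMinimizer i W C V γ →
        (∃ g π, M.IsBelief (M.withStrategy Γ i g) i π ∧ M.FollowsFrom i 1 g π γ ∧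
          M.IsOptimal Γ i g) ∧
        (∀ g π, M.IsBelief (M.withStrategy Γ i g) i π → M.FollowsFrom i 1 g π γ →
          M.IsOptimal Γ i g) ∧
        (∀ t ∈ Finset.Icc 1 M.T, ∀ g π, M.IsBelief (M.withStrategy Γ i g) i π →
          M.FollowsFrom i t g π γ → M.IsOptimalFrom Γ i t g) := by
  refine ⟨⟨_, _, _, SeqDetect.DetectionModel.isDynamicProgram_valueFn Γ i⟩,
    fun W C V h => ⟨h.exists_isMinimizer, fun γ hγ => ?_⟩⟩
  have hopt : ∀ g π, M.IsBelief (M.withStrategy Γ i g) i π → M.FollowsFrom i 1 g π γ →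
      M.IsOptimal Γ i g := fun g π hπ hg => (hg.attainsFrom h hγ le_rfl hπ).isOptimal
  refine ⟨?_, hopt, fun t ht g π hπ hg =>
    (hg.attainsFrom h hγ (Finset.mem_Icc.mp ht).1 hπ).isOptimalFrom ht⟩
  obtain ⟨g, hg⟩ := SeqDetect.DetectionModel.exists_followsFrom (Γ := Γ) hγ
  have hb := SeqDetect.DetectionModel.isBelief_belief Γ g
  exact ⟨g, _, hb, hg, hopt g _ hb hg⟩
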